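/- Let $q\ge1$, $n\ge1$, let $\Omega_q=\{x\in\mathbb R^{q+1}:x'x=1\}$, let $\nu_q$ be the uniform distribution on $\Omega_q$, and let $F_q$ be the cdf of $\gamma'u$, where $\gamma\sim\nu_q$ and $u\in\Omega_q$ is any fixed vector. For $\mathbf X_1,\dots,\mathbf X_n\in\Omega_q$ and $\gamma\in\Omega_q$, let $F_{n,\gamma}(x)=\frac1n\#\{i:\gamma'\mathbf X_i\le x\}$ and $\theta_{ij}=\cos^{-1}(\mathbf X_i'\mathbf X_j)\in[0,\pi]$. For a cdf $W$ on $[0,1]$ put $$P_{n,q}^W=n\int_{\Omega_q}\int_{-1}^1\bigl(F_{n,\gamma}(x)-F_q(x)\bigr)^2\,\mathrm dW(F_q(x))\,\nu_q(\mathrm d\gamma),\qquad \psi_q^W(\theta)=\int_{-1}^1A(\theta,x)\,\mathrm dW(F_q(x)),$$ where $A(\theta,x)=\nu_q\{\gamma:\gamma'u\le x,\ \gamma'v\le x\}$ for unit vectors $u,v\in\mathbb R^{q+1}$ at angle $\theta\in[0,\pi]$. Let the superscript CvM stand for the choice $W(x)=x$, $x\in[0,1]$. Then: 1. For all $q\ge1$,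 $n\ge1$ and $\mathbf X_1,\dots,\mathbf X_n\in\Omega_q$, $$P_{n,q}^{\mathrm{CvM}}=\frac2n\sum_{i<j}\psi_q^{\mathrm{CvM}}(\theta_{ij})+\frac{3-2n}{6}.$$ 2. For $\theta\in[0,\pi]$, $$\psi_1^{\mathrm{CvM}}(\theta)=\tfrac12+\tfrac{\theta}{2\pi}\Bigl(\tfrac{\theta}{2\pi}-1\Bigr),\qquad \psi_2^{\mathrm{CvM}}(\theta)=\tfrac12-\tfrac14\sin\bigl(\tfrac\theta2\bigr),$$ and for $\theta\in[0,\pi)$, $$\psi_3^{\mathrm{CvM}}(\theta)=\psi_1^{\mathrm{CvM}}(\theta)+\frac1{4\pi^2}\Bigl((\pi-\theta)\tan\bigl(\tfrac\theta2\bigr)-2\sin^2\bigl(\tfrac\theta2\bigr)\Bigr),$$ while $\psi_3^{\mathrm{CvM}}(\pi)=\frac14$ (the limit of the right-hand side as $\theta\uparrow\pi$). 3. For all $q\ge2$ and $\theta\in[0,\pi]$, $$\psi_q^{\mathrm{CvM}}(\theta)=-\frac34+\frac{\theta}{2\pi}+2F_q^2\bigl(\cos(\tfrac\theta2)\bigr)-4\int_0^{\cos(\theta/2)}F_q(t)\,F_{q-1}\Bigl(\frac{t\tan(\theta/2)}{(1-t^2)^{1/2}}\Bigr)\,\mathrm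 dF_q(t)$$ (for $\theta=\pi$ the integral is over an empty interval and equals $0$). 4. (Watson.) If $q=1$ and $\mathbf X_i=(\cos\Theta_i,\sin\Theta_i)'$ with $\Theta_i\in[0,2\pi)$, then $P_{n,1}^{\mathrm{CvM}}=2U_n^2$, where $$U_n^2=n\int_0^{2\pi}\Bigl\{G_n(\theta)-G(\theta)-\int_0^{2\pi}\bigl(G_n(\varphi)-G(\varphi)\bigr)\,\mathrm dG(\varphi)\Bigr\}^2\,\mathrm dG(\theta),$$ with $G_n(\theta)=\frac1n\#\{i:\Theta_i\le\theta\}$ and $G(\theta)=\theta/(2\pi)$. 5. (Bakshaev.) If $q=2$, then $P_{n,2}^{\mathrm{CvM}}=\frac18N_{n,2}$, where $$N_{n,q}=n\,\mathbb E\|\mathbf Y_1-\mathbf Y_2\|-\frac1n\sum_{i,j=1}^n\|\mathbf X_i-\mathbf X_j\|,$$ and $\mathbf Y_1,\mathbf Y_2$ are independent with distribution $\nu_q$. -/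

import Mathlib

open MeasureTheory ProbabilityTheory
open scoped RealInnerProductSpace

namespace ProjUnif

/-- The unit sphere `Ω_q` of `ℝ^(q+1)`. -/
abbrev Sphere (q : ℕ) : Type :=
  Metric.sphere (0 : EuclideanSpace ℝ (Fin (q + 1))) 1

/-- The uniform distribution `ν_q` on `Ω_q`: normalized surface measure. -/
noncomputable def uniformSphere (q : ℕ) : Measure (Sphere q) :=
  ((volume : Measure (EuclideanSpace ℝ (Fin (q + 1)))).toSphere Set.univ)⁻¹ •
    (volume : Measure (EuclideanSpace ℝ (Fin (q + 1)))).toSphere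

/-- The projected uniform distribution: the law under `ν_q` of one coordinate
(by rotation invariance, of the projection on any unit vector). -/
noncomputable def projLaw (q : ℕ) : Measure ℝ :=
  (uniformSphere q).map (fun γ : Sphere q => (γ : EuclideanSpace ℝ (Fin (q + 1))) 0)

/-- `F_q`, the cdf of the projected uniform distribution. -/
noncomputable def F (q : ℕ) : StieltjesFunction ℝ := cdf (projLaw q)

/-- The function `x ↦ W (F_q x)`; its Lebesgue-Stieltjes measure is `dW(F_q(x))`. -/
noncomputable def compF (W : StieltjesFunction ℝ) (q : ℕ) : StieltjesFunction ℝ where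
  toFun x := W (F q x)
  mono' := W.mono.comp (F q).mono
  right_continuous' x :=
    (W.right_continuous (F q x)).comp ((F q).right_continuous x)
      (fun _ hy => (F q).mono hy)

/-- The Cramér–von Mises cdf, `W(x) = x` on `[0,1]` (equal to `0` to the left, `1` to the right). -/
noncomputable def cvmCdf : StieltjesFunction ℝ where
  toFun x := max 0 (min x 1)
  mono' _ _ h := max_le_max le_rfl (min_le_min h le_rfl)
  right_continuous' _ :=
    (continuous_const.max (continuous_id.min continuous_const)).continuousWithinAt

/-- The ecdf at `x` of the projections of the sample `X` on `γ`. -/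
noncomputable def projEcdf {q n : ℕ} (X : Fin n → Sphere q) (γ : Sphere q) (x : ℝ) : ℝ :=
  (n : ℝ)⁻¹ * ∑ i, if ⟪(γ : EuclideanSpace ℝ (Fin (q + 1))), X i⟫ ≤ x then (1 : ℝ) else 0

/-- The statistic `P_{n,q}^W`, for a cdf `W` on `[0,1]`. -/
noncomputable def P (W : StieltjesFunction ℝ) (q : ℕ) {n : ℕ} (X : Fin n → Sphere q) : ℝ :=
  n * ∫ γ, (∫ x in Set.Icc (-1 : ℝ) 1, (projEcdf X γ x - F q x) ^ 2 ∂(compF W q).measure)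
    ∂uniformSphere q

/-- The unit vector `(cos θ, sin θ, 0, …, 0)` of `ℝ^(q+1)`, `q ≥ 1`. -/
noncomputable def dir (q : ℕ) (θ : ℝ) : EuclideanSpace ℝ (Fin (q + 1)) :=
  WithLp.toLp 2 fun i =>
    if (i : ℕ) = 0 then Real.cos θ else if (i : ℕ) = 1 then Real.sin θ else 0

/-- `A(θ, x)`: the `ν_q`-probability that the projections of `γ` on two unit vectors at
angle `θ` are both at most `x`. -/
noncomputable def A (q : ℕ) (θ x : ℝ) : ℝ :=
  (uniformSphere q).real
    {γ | ⟪(γ : EuclideanSpace ℝ (Fin (q + 1))), dir q 0⟫ ≤ x ∧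
      ⟪(γ : EuclideanSpace ℝ (Fin (q + 1))), dir q θ⟫ ≤ x}

/-- The kernel `ψ_q^W(θ) = ∫_{[-1,1]} A(θ, x) dW(F_q(x))`. -/
noncomputable def psi (W : StieltjesFunction ℝ) (q : ℕ) (θ : ℝ) : ℝ :=
  ∫ x in Set.Icc (-1 : ℝ) 1, A q θ x ∂(compF W q).measure

/-- The angle `θ_ij ∈ [0, π]` between two points of the sphere. -/
noncomputable def angle {q : ℕ} (u v : Sphere q) : ℝ :=
  Real.arccos ⟪(u : EuclideanSpace ℝ (Fin (q + 1))), v⟫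

/-- `G_n(φ) - G(φ)` for a circular sample `Θ` in `[0, 2π)`. -/
noncomputable def circDiscrepancy {n : ℕ} (Θ : Fin n → ℝ) (φ : ℝ) : ℝ :=
  (n : ℝ)⁻¹ * (∑ i, if Θ i ≤ φ then (1 : ℝ) else 0) - φ / (2 * Real.pi)

/-- Watson's statistic `U_n²`; here `dG(θ) = dθ / (2π)` on `[0, 2π)`. -/
noncomputable def watson {n : ℕ} (Θ : Fin n → ℝ) : ℝ :=
  n * ((2 * Real.pi)⁻¹ * ∫ θ in (0 : ℝ)..(2 * Real.pi),
    (circDiscrepancy Θ θ -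
      (2 * Real.pi)⁻¹ * ∫ φ in (0 : ℝ)..(2 * Real.pi), circDiscrepancy Θ φ) ^ 2)

/-- Bakshaev's chordal statistic `N_{n,q}`, the expectation being taken for two independent
uniformly distributed points. -/
noncomputable def bakshaev (q : ℕ) {n : ℕ} (X : Fin n → Sphere q) : ℝ :=
  n * (∫ u, (∫ v, ‖(u : EuclideanSpace ℝ (Fin (q + 1))) - v‖ ∂uniformSphere q)
      ∂uniformSphere q)
    - (n : ℝ)⁻¹ * ∑ i, ∑ j, ‖(X i : EuclideanSpace ℝ (Fin (q + 1))) - X j‖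

end ProjUnif

namespace ProjUnif

/-! Put a = γ'u and b = γ'v. Integrating the indicator of max(a, b) ≤ x against dF_q(x) before γ
gives ψ(θ) = E[1 - F_q(max(a, b))] (`psi_eq`), which by rotation invariance depends on the angle
alone. In P the square expands into products of such indicators, a cross term and F_q². Since
F_q(γ'X_i) is uniform on [0, 1], the last two contribute constants, so P = n⁻¹ ∑∑ ψ(θ_ij) - n/3
(`P_eq_double_sum`). The diagonal ψ(0) = 1/2 then yields the constant (3 - 2n)/6.

Exchanging u and v turns the kernel into 1 - 2 E[F_q(γ₀); b < a], and in adapted coordinates b < a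
reads γ₁ < tan(θ/2) γ₀ (`psi_eq_sub_two_mul`). Given γ₀ = t, the ratio γ₁ / √(1 - t²) is a
projection of a uniform point one dimension lower. This brings in F_{q-1} and rests on the polar
form γ = (cos α, sin α · η) with independent α and η (`lintegral_uniformSphere_slice`). Folding t to
-t produces the probability of a planar sector, whence the term linear in θ. Beyond cos(θ/2) the
factor F_{q-1} equals 1, whence the term in F_q² (`psi_formula`).

The closed forms come from F_1(cos φ) = 1 - |φ|/π, from F_2 being affine (so max(a, b) = (a + b + |a
- b|)/2 makes ψ_2 affine in the chord, `psi_two_eq_norm`), and for q = 3 from an explicit primitive.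
Watson's identity compares two expressions in moments and pairwise maxima of the sample. Bakshaev's
needs only the chordal form of ψ_2 and the mean chord length 4/3. -/

/-! ### Slicing the sphere along a coordinate -/

/-- Lebesgue measure in spherical coordinates. -/
lemma lintegral_eq_lintegral_toSphere (m : ℕ) {f : EuclideanSpace ℝ (Fin (m + 1)) → ENNReal}
    (hf : Measurable f) :
    ∫⁻ x, f x = ∫⁻ γ : Sphere m, (∫⁻ r in Set.Ioi (0 : ℝ),
      ENNReal.ofReal (r ^ m) * f (r • (γ : EuclideanSpace ℝ (Fin (m + 1)))))
      ∂(volume : Measure (EuclideanSpace ℝ (Fin (m + 1)))).toSphere := by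
  let E := EuclideanSpace ℝ (Fin (m + 1))
  have hmp := (volume : Measure E).measurePreserving_homeomorphUnitSphereProd
  have hdim : Module.finrank ℝ E - 1 = m := by simp [E]
  rw [hdim] at hmp
  have h1 : ∫⁻ x, f x = ∫⁻ x : ({0}ᶜ : Set E), f x ∂((volume : Measure E).comap (↑)) := by
    rw [lintegral_subtype_comap (measurableSet_singleton _).compl,
      setLIntegral_congr (ae_eq_univ.2 (by simp) : ({0}ᶜ : Set E) =ᵐ[volume] Set.univ),
      setLIntegral_univ]
  have h2 := hmp.lintegral_comp_emb (homeomorphUnitSphereProd E).measurableEmbedding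
    (fun p => f ((p.2 : ℝ) • (p.1 : E)))
  have h3 : ∀ x : ({0}ᶜ : Set E),
      ((homeomorphUnitSphereProd E x).2 : ℝ) • ((homeomorphUnitSphereProd E x).1 : E) = x := by
    intro x
    rw [← homeomorphUnitSphereProd_symm_apply_coe, Homeomorph.symm_apply_apply]
  simp only [h3] at h2
  refine h1.trans (h2.trans ?_)
  rw [lintegral_prod _ (by fun_prop)]
  refine lintegral_congr fun γ => ?_
  rw [Measure.volumeIoiPow, lintegral_withDensity_eq_lintegral_mul _ (by fun_prop) (by fun_prop)]
  exact lintegral_subtype_comap measurableSet_Ioi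
    (fun r : ℝ => ENNReal.ofReal (r ^ m) * f (r • (γ : E)))

/-- Lebesgue measure on `ℝ^(m+1)` as a product, the first coordinate split off. -/
lemma lintegral_eq_lintegral_cons (m : ℕ) {f : EuclideanSpace ℝ (Fin (m + 1)) → ENNReal}
    (hf : Measurable f) :
    ∫⁻ x, f x = ∫⁻ y : ℝ, ∫⁻ z : EuclideanSpace ℝ (Fin m),
      f (WithLp.toLp 2 (Fin.cons y z.ofLp)) := by
  have h1 := (PiLp.volume_preserving_toLp (Fin (m + 1))).lintegral_comp hf
  have h2 := (volume_preserving_piFinSuccAbove (fun _ : Fin (m + 1) => ℝ) 0).symm.lintegral_comp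
    (f := fun x => f (WithLp.toLp 2 x)) (by fun_prop)
  rw [← h1, ← h2, Measure.volume_eq_prod, lintegral_prod _ (by fun_prop)]
  refine lintegral_congr fun y => ?_
  have hm : Measurable fun z : EuclideanSpace ℝ (Fin m) =>
      f (WithLp.toLp 2 (Fin.cons y z.ofLp : Fin (m + 1) → ℝ)) := by
    refine hf.comp (Measurable.comp (by fun_prop) ?_)
    refine measurable_pi_iff.2 fun i => ?_
    refine Fin.cases ?_ (fun j => ?_) i
    · simp
    · simp only [Fin.cons_succ]; fun_prop
  rw [← (PiLp.volume_preserving_toLp (Fin m)).lintegral_comp hm]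
  refine lintegral_congr fun z => ?_
  simp [MeasurableEquiv.piFinSuccAbove, Fin.insertNthEquiv]

/-- Polar coordinates in the upper half plane. -/
lemma lintegral_halfPlane_polar {g : ℝ × ℝ → ENNReal} (hg : Measurable g) :
    ∫⁻ y : ℝ, ∫⁻ r in Set.Ioi (0 : ℝ), g (y, r) =
      ∫⁻ s in Set.Ioi (0 : ℝ), ∫⁻ α in Set.Ioo 0 Real.pi,
        ENNReal.ofReal s * g (s * Real.cos α, s * Real.sin α) := by
  have hS : MeasurableSet {p : ℝ × ℝ | 0 < p.2} := measurableSet_lt (by fun_prop) (by fun_prop)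
  -- Polar coordinates of the full plane, applied to `g` extended by zero: positivity of the sine
  -- then cuts the angle down to (0, π).
  have h := lintegral_comp_polarCoord_symm (Set.indicator {p : ℝ × ℝ | 0 < p.2} g)
  have hR : ∫⁻ p, Set.indicator {p : ℝ × ℝ | 0 < p.2} g p =
      ∫⁻ y : ℝ, ∫⁻ r in Set.Ioi (0 : ℝ), g (y, r) := by
    rw [Measure.volume_eq_prod, lintegral_prod _ ((hg.indicator hS).aemeasurable)]
    refine lintegral_congr fun y => ?_
    rw [← lintegral_indicator measurableSet_Ioi]
    rfl
  have hm : Measurable fun p : ℝ × ℝ => ENNReal.ofReal p.1 •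
      Set.indicator {p : ℝ × ℝ | 0 < p.2} g (polarCoord.symm p) :=
    (by fun_prop : Measurable fun p : ℝ × ℝ => ENNReal.ofReal p.1).smul
      ((hg.indicator hS).comp continuous_polarCoord_symm.measurable)
  rw [← hR, ← h, show polarCoord.target = Set.Ioi (0 : ℝ) ×ˢ Set.Ioo (-Real.pi) Real.pi from rfl,
    Measure.volume_eq_prod, ← Measure.prod_restrict, lintegral_prod _ hm.aemeasurable]
  refine setLIntegral_congr_fun measurableSet_Ioi fun s hs => ?_
  have hs : 0 < s := hs
  rw [← lintegral_indicator measurableSet_Ioo, ← lintegral_indicator measurableSet_Ioo]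
  refine lintegral_congr fun α => ?_
  simp only [Set.indicator, polarCoord_symm_apply, Set.mem_ofPred_eq, smul_eq_mul, Set.mem_Ioo]
  by_cases h1 : 0 < α ∧ α < Real.pi
  · have := Real.sin_pos_of_pos_of_lt_pi h1.1 h1.2
    rw [if_pos h1, if_pos ⟨by linarith [h1.1, h1.2], h1.2⟩, if_pos (by positivity)]
  · rw [if_neg h1]
    split_ifs with h2 h3
    · exfalso
      refine h1 ⟨?_, h2.2⟩
      by_contra h4
      have := Real.sin_nonpos_of_nonpos_of_neg_pi_le (not_lt.1 h4) h2.1.le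
      nlinarith
    · simp
    · rfl

/-- The point of the sphere with polar angle `α` and equatorial direction `z`. -/
noncomputable def slice {m : ℕ} (α : ℝ) (z : EuclideanSpace ℝ (Fin m)) :
    EuclideanSpace ℝ (Fin (m + 1)) :=
  WithLp.toLp 2 (Fin.cons (Real.cos α) fun i => Real.sin α * z i)

@[simp] lemma slice_zero {m : ℕ} (α : ℝ) (z : EuclideanSpace ℝ (Fin m)) :
    slice α z 0 = Real.cos α := rfl

@[simp] lemma slice_succ {m : ℕ} (α : ℝ) (z : EuclideanSpace ℝ (Fin m)) (i : Fin m) :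
    slice α z i.succ = Real.sin α * z i := rfl

@[simp] lemma slice_one {m : ℕ} (α : ℝ) (z : EuclideanSpace ℝ (Fin (m + 1))) :
    slice α z 1 = Real.sin α * z 0 := rfl

@[fun_prop]
lemma measurable_slice {m : ℕ} :
    Measurable fun p : ℝ × EuclideanSpace ℝ (Fin m) => slice p.1 p.2 := by
  refine Measurable.comp (by fun_prop) (measurable_pi_iff.2 fun i => ?_)
  refine Fin.cases ?_ (fun j => ?_) i
  · simp only [Fin.cons_zero]; fun_prop
  · simp only [Fin.cons_succ]; fun_prop

lemma norm_slice {m : ℕ} (α : ℝ) {z : EuclideanSpace ℝ (Fin m)} (hz : ‖z‖ = 1) :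
    ‖slice α z‖ = 1 := by
  have h : ∑ i, z i ^ 2 = 1 := by
    have := EuclideanSpace.real_norm_sq_eq z
    rw [← this, hz, one_pow]
  rw [EuclideanSpace.norm_eq, Real.sqrt_eq_one, Fin.sum_univ_succ]
  simp only [slice_zero, slice_succ, Real.norm_eq_abs, sq_abs, mul_pow, ← Finset.mul_sum, h]
  rw [mul_one, Real.cos_sq_add_sin_sq]

lemma cons_eq_smul_slice {m : ℕ} (s α : ℝ) (z : EuclideanSpace ℝ (Fin m)) :
    (WithLp.toLp 2 (Fin.cons (s * Real.cos α) ((s * Real.sin α) • z).ofLp) :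
      EuclideanSpace ℝ (Fin (m + 1))) = s • slice α z := by
  ext i
  refine Fin.cases ?_ (fun j => ?_) i
  · simp
  · simp [mul_assoc]

/-- A radial weight on `ℝ^(m+1)` of unit mass in the radial direction. -/
noncomputable def radialWeight (m : ℕ) : ℝ → ENNReal :=
  Set.indicator (Set.Ioo 0 1) fun r => (ENNReal.ofReal (r ^ m))⁻¹

@[fun_prop]
lemma measurable_radialWeight (m : ℕ) : Measurable (radialWeight m) :=
  Measurable.indicator (by fun_prop) measurableSet_Ioo

lemma lintegral_radialWeight (m : ℕ) :
    ∫⁻ s in Set.Ioi (0 : ℝ), ENNReal.ofReal (s ^ m) * radialWeight m s = 1 := by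
  have : ∀ s : ℝ, ENNReal.ofReal (s ^ m) * radialWeight m s =
      Set.indicator (Set.Ioo 0 1) (fun _ => 1) s := by
    intro s
    by_cases hs : s ∈ Set.Ioo (0 : ℝ) 1
    · have : 0 < s ^ m := pow_pos hs.1 _
      simp only [radialWeight, Set.indicator_of_mem hs]
      exact ENNReal.mul_inv_cancel (by simpa using this) ENNReal.ofReal_ne_top
    · simp [radialWeight, Set.indicator_of_notMem hs]
  simp_rw [this]
  rw [lintegral_indicator measurableSet_Ioo, setLIntegral_one,
    Measure.restrict_apply measurableSet_Ioo, Set.inter_eq_left.2 (fun x hx => hx.1)]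
  simp

/-- Surface integrals as integrals over the ambient space. -/
lemma lintegral_radialWeight_mul (m : ℕ) {h : EuclideanSpace ℝ (Fin (m + 1)) → ENNReal}
    (hh : Measurable h) :
    ∫⁻ x : EuclideanSpace ℝ (Fin (m + 1)), radialWeight m ‖x‖ * h (‖x‖⁻¹ • x) =
      ∫⁻ γ : Sphere m, h γ ∂(volume : Measure (EuclideanSpace ℝ (Fin (m + 1)))).toSphere := by
  rw [lintegral_eq_lintegral_toSphere m (by fun_prop)]
  refine lintegral_congr fun γ => ?_
  have : ∀ r ∈ Set.Ioi (0 : ℝ), ENNReal.ofReal (r ^ m) *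
      (radialWeight m ‖r • (γ : EuclideanSpace ℝ (Fin (m + 1)))‖ *
        h (‖r • (γ : EuclideanSpace ℝ (Fin (m + 1)))‖⁻¹ •
          r • (γ : EuclideanSpace ℝ (Fin (m + 1))))) =
      ENNReal.ofReal (r ^ m) * radialWeight m r * h γ := by
    intro r hr
    have hr : 0 < r := hr
    have hn : ‖r • (γ : EuclideanSpace ℝ (Fin (m + 1)))‖ = r := by
      rw [norm_smul, norm_eq_of_mem_sphere, mul_one, Real.norm_of_nonneg hr.le]
    rw [hn, smul_smul, inv_mul_cancel₀ hr.ne', one_smul, mul_assoc]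
  rw [setLIntegral_congr_fun measurableSet_Ioi this, lintegral_mul_const _ (by fun_prop),
    lintegral_radialWeight, one_mul]

/-- Surface measure in polar form: the polar angle has density `sin ^ m`, and the
equatorial direction is spread by the surface measure one dimension lower. -/
lemma lintegral_toSphere_eq_slice (m : ℕ) {h : EuclideanSpace ℝ (Fin (m + 2)) → ENNReal}
    (hh : Measurable h) :
    ∫⁻ γ : Sphere (m + 1), h γ ∂(volume : Measure (EuclideanSpace ℝ (Fin (m + 2)))).toSphere =
      ∫⁻ α in Set.Ioo 0 Real.pi, ENNReal.ofReal (Real.sin α ^ m) *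
        ∫⁻ η : Sphere m, h (slice α η)
          ∂(volume : Measure (EuclideanSpace ℝ (Fin (m + 1)))).toSphere := by
  set w : ℝ → ENNReal := radialWeight (m + 1)
  have hwm : Measurable w := measurable_radialWeight _
  have hK : ∫⁻ s in Set.Ioi (0 : ℝ), ENNReal.ofReal (s ^ (m + 1)) * w s = 1 :=
    lintegral_radialWeight _
  have hfm : Measurable fun x : EuclideanSpace ℝ (Fin (m + 2)) => w ‖x‖ * h (‖x‖⁻¹ • x) := by
    fun_prop
  have hL := lintegral_radialWeight_mul (m + 1) hh
  have hcons : Measurable fun p : ℝ × EuclideanSpace ℝ (Fin (m + 1)) =>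
      (WithLp.toLp 2 (Fin.cons p.1 p.2.ofLp) : EuclideanSpace ℝ (Fin (m + 2))) := by
    refine Measurable.comp (by fun_prop) (measurable_pi_iff.2 fun i => ?_)
    refine Fin.cases ?_ (fun j => ?_) i
    · simp only [Fin.cons_zero]; fun_prop
    · simp only [Fin.cons_succ]; fun_prop
  -- Split off the first coordinate y, take spherical coordinates of radius r in the rest, then
  -- polar coordinates (s, α) for the pair (y, r). With r = s sin α the Jacobians r ^ m and s
  -- combine to s ^ (m + 1) sin ^ m α, and the radial weight absorbs the power of s.
  have hR : ∫⁻ x : EuclideanSpace ℝ (Fin (m + 2)), w ‖x‖ * h (‖x‖⁻¹ • x) =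
      ∫⁻ η : Sphere m, (∫⁻ s in Set.Ioi (0 : ℝ), ∫⁻ α in Set.Ioo 0 Real.pi,
        ENNReal.ofReal (s ^ (m + 1)) * w s *
          (ENNReal.ofReal (Real.sin α ^ m) * h (slice α η)))
        ∂(volume : Measure (EuclideanSpace ℝ (Fin (m + 1)))).toSphere := by
    rw [lintegral_eq_lintegral_cons (m + 1) hfm]
    set f : EuclideanSpace ℝ (Fin (m + 2)) → ENNReal := fun x => w ‖x‖ * h (‖x‖⁻¹ • x)
    have h1 : ∀ y : ℝ, ∫⁻ z : EuclideanSpace ℝ (Fin (m + 1)),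
        f (WithLp.toLp 2 (Fin.cons y z.ofLp)) =
        ∫⁻ η : Sphere m, (∫⁻ r in Set.Ioi (0 : ℝ), ENNReal.ofReal (r ^ m) *
          f (WithLp.toLp 2 (Fin.cons y (r • (η : EuclideanSpace ℝ (Fin (m + 1)))).ofLp)))
          ∂(volume : Measure (EuclideanSpace ℝ (Fin (m + 1)))).toSphere := fun y =>
      lintegral_eq_lintegral_toSphere m
        (hfm.comp (hcons.comp (measurable_const.prodMk measurable_id)))
    refine (lintegral_congr h1).trans ?_
    have hmeas : Measurable fun p : (Sphere m × ℝ) × ℝ => ENNReal.ofReal (p.2 ^ m) *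
        f (WithLp.toLp 2 (Fin.cons p.1.2
          (p.2 • (p.1.1 : EuclideanSpace ℝ (Fin (m + 1)))).ofLp)) := by
      refine Measurable.mul (by fun_prop) (hfm.comp ?_)
      exact hcons.comp (f := fun p : (Sphere m × ℝ) × ℝ =>
        (p.1.2, p.2 • (p.1.1 : EuclideanSpace ℝ (Fin (m + 1))))) (by fun_prop)
    rw [lintegral_lintegral_swap]
    · refine lintegral_congr fun η => ?_
      have h2 := lintegral_halfPlane_polar (g := fun p : ℝ × ℝ => ENNReal.ofReal (p.2 ^ m) *
        f (WithLp.toLp 2 (Fin.cons p.1 (p.2 • (η : EuclideanSpace ℝ (Fin (m + 1)))).ofLp)))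
        (hmeas.comp (g := fun p : (Sphere m × ℝ) × ℝ => _)
          (f := fun p : ℝ × ℝ => ((η, p.1), p.2)) (by fun_prop))
      rw [h2]
      refine setLIntegral_congr_fun measurableSet_Ioi fun s hs => ?_
      refine setLIntegral_congr_fun measurableSet_Ioo fun α hα => ?_
      have hs : 0 < s := hs
      have hsin := Real.sin_pos_of_pos_of_lt_pi hα.1 hα.2
      have hn : ‖s • slice α (η : EuclideanSpace ℝ (Fin (m + 1)))‖ = s := by
        rw [norm_smul, norm_slice α (norm_eq_of_mem_sphere η), mul_one, Real.norm_of_nonneg hs.le]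
      simp only [f]
      rw [cons_eq_smul_slice, hn, smul_smul, inv_mul_cancel₀ hs.ne', one_smul, mul_pow,
        ENNReal.ofReal_mul (by positivity), pow_succ, ENNReal.ofReal_mul (by positivity)]
      ring
    · refine Measurable.aemeasurable ?_
      exact (hmeas.comp (g := fun p : (Sphere m × ℝ) × ℝ => _)
        (f := fun p : (ℝ × Sphere m) × ℝ => ((p.1.2, p.1.1), p.2))
        (by fun_prop)).lintegral_prod_right'
  rw [← hL, hR]
  have hm2 : Measurable fun p : Sphere m × ℝ => h (slice p.2 p.1) :=
    hh.comp (measurable_slice.comp (f := fun p : Sphere m × ℝ =>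
      (p.2, (p.1 : EuclideanSpace ℝ (Fin (m + 1))))) (by fun_prop))
  have h3 : ∀ η : Sphere m, (∫⁻ s in Set.Ioi (0 : ℝ), ∫⁻ α in Set.Ioo 0 Real.pi,
        ENNReal.ofReal (s ^ (m + 1)) * w s *
          (ENNReal.ofReal (Real.sin α ^ m) * h (slice α η))) =
      ∫⁻ α in Set.Ioo 0 Real.pi, (ENNReal.ofReal (Real.sin α ^ m) * h (slice α η)) := by
    intro η
    have hmη : Measurable fun α : ℝ => h (slice α (η : EuclideanSpace ℝ (Fin (m + 1)))) :=
      hm2.comp (f := fun α : ℝ => (η, α)) (by fun_prop)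
    simp_rw [fun s : ℝ => lintegral_const_mul (μ := volume.restrict (Set.Ioo 0 Real.pi))
      (ENNReal.ofReal (s ^ (m + 1)) * w s)
      (by fun_prop : Measurable fun α : ℝ => ENNReal.ofReal (Real.sin α ^ m) * h (slice α η))]
    rw [lintegral_mul_const _ (by fun_prop), hK, one_mul]
  simp_rw [h3]
  rw [lintegral_lintegral_swap (by
    refine Measurable.aemeasurable ?_
    exact Measurable.mul (by fun_prop) hm2)]
  refine lintegral_congr fun α => ?_
  rw [lintegral_const_mul]
  exact hm2.comp (f := fun η : Sphere m => (η, α)) (by fun_prop)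

/-! ### The uniform distribution: rotation invariance and polar form -/

lemma toSphere_univ_ne_zero (q : ℕ) :
    (volume : Measure (EuclideanSpace ℝ (Fin (q + 1)))).toSphere Set.univ ≠ 0 := by
  rw [Ne, Measure.measure_univ_eq_zero]
  exact Measure.toSphere_ne_zero _

instance (q : ℕ) : IsProbabilityMeasure (uniformSphere q) := by
  constructor
  rw [uniformSphere, Measure.smul_apply, smul_eq_mul]
  exact ENNReal.inv_mul_cancel (toSphere_univ_ne_zero q) (measure_ne_top _ _)

lemma lintegral_uniformSphere (q : ℕ) (f : Sphere q → ENNReal) :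
    ∫⁻ γ, f γ ∂uniformSphere q =
      ((volume : Measure (EuclideanSpace ℝ (Fin (q + 1)))).toSphere Set.univ)⁻¹ *
        ∫⁻ γ, f γ ∂(volume : Measure (EuclideanSpace ℝ (Fin (q + 1)))).toSphere := by
  rw [uniformSphere, lintegral_smul_measure, smul_eq_mul]

instance (q : ℕ) : IsProbabilityMeasure (projLaw q) :=
  Measure.isProbabilityMeasure_map (by fun_prop)

lemma lintegral_projLaw (q : ℕ) {f : ℝ → ENNReal} (hf : Measurable f) :
    ∫⁻ t, f t ∂projLaw q =
      ∫⁻ γ, f ((γ : EuclideanSpace ℝ (Fin (q + 1))) 0) ∂uniformSphere q := by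
  rw [projLaw, lintegral_map hf (by fun_prop)]

/-- Rotation invariance of the uniform distribution. -/
lemma lintegral_uniformSphere_isometry (q : ℕ)
    (e : EuclideanSpace ℝ (Fin (q + 1)) ≃ₗᵢ[ℝ] EuclideanSpace ℝ (Fin (q + 1)))
    {h : EuclideanSpace ℝ (Fin (q + 1)) → ENNReal} (hh : Measurable h) :
    ∫⁻ γ, h (e γ) ∂uniformSphere q = ∫⁻ γ, h γ ∂uniformSphere q := by
  have he : Measurable e := e.continuous.measurable
  rw [lintegral_uniformSphere, lintegral_uniformSphere, ← lintegral_radialWeight_mul q hh,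
    ← lintegral_radialWeight_mul q (h := fun x => h (e x)) (by fun_prop),
    ← e.measurePreserving.lintegral_comp
      (f := fun x => radialWeight q ‖x‖ * h (‖x‖⁻¹ • x)) (by fun_prop)]
  congr 2
  ext x
  rw [e.norm_map, map_smul]

/-- The law of the polar angle on the `(m+1)`-dimensional sphere, with density proportional to
`sin ^ m` on `(0, π)`. -/
noncomputable def angleLaw (m : ℕ) : Measure ℝ :=
  (∫⁻ α in Set.Ioo 0 Real.pi, ENNReal.ofReal (Real.sin α ^ m))⁻¹ •
    (volume.restrict (Set.Ioo 0 Real.pi)).withDensity fun α => ENNReal.ofReal (Real.sin α ^ m)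

lemma lintegral_angleLaw (m : ℕ) {f : ℝ → ENNReal} (hf : Measurable f) :
    ∫⁻ α, f α ∂angleLaw m = (∫⁻ α in Set.Ioo 0 Real.pi, ENNReal.ofReal (Real.sin α ^ m))⁻¹ *
      ∫⁻ α in Set.Ioo 0 Real.pi, ENNReal.ofReal (Real.sin α ^ m) * f α := by
  rw [angleLaw, lintegral_smul_measure, smul_eq_mul,
    lintegral_withDensity_eq_lintegral_mul _ (by fun_prop) hf]
  rfl

lemma lintegral_sin_pow_ne_zero (m : ℕ) :
    ∫⁻ α in Set.Ioo 0 Real.pi, ENNReal.ofReal (Real.sin α ^ m) ≠ 0 := by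
  rw [← pos_iff_ne_zero, setLIntegral_pos_iff (by fun_prop)]
  have : Set.Ioo 0 Real.pi ⊆ Function.support (fun α => ENNReal.ofReal (Real.sin α ^ m)) := by
    intro α hα
    have := pow_pos (Real.sin_pos_of_pos_of_lt_pi hα.1 hα.2) m
    simpa using this
  rw [Set.inter_eq_right.2 this]
  simp [Real.pi_pos]

lemma lintegral_sin_pow_ne_top (m : ℕ) :
    ∫⁻ α in Set.Ioo 0 Real.pi, ENNReal.ofReal (Real.sin α ^ m) ≠ ⊤ := by
  refine ne_top_of_le_ne_top (b := ENNReal.ofReal Real.pi) (by simp) ?_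
  calc _ ≤ ∫⁻ α in Set.Ioo 0 Real.pi, (1 : ENNReal) :=
        setLIntegral_mono (by fun_prop) fun α hα => by
          rw [ENNReal.ofReal_le_one]
          exact pow_le_one₀ (Real.sin_pos_of_pos_of_lt_pi hα.1 hα.2).le (Real.sin_le_one α)
    _ = ENNReal.ofReal Real.pi := by simp

instance (m : ℕ) : IsProbabilityMeasure (angleLaw m) := by
  constructor
  rw [← lintegral_one, lintegral_angleLaw m measurable_const]
  simp only [mul_one]
  exact ENNReal.inv_mul_cancel (lintegral_sin_pow_ne_zero m) (lintegral_sin_pow_ne_top m)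

/-- A uniform point of the sphere in polar form: independent polar angle and uniform
equatorial direction. -/
lemma lintegral_uniformSphere_slice (m : ℕ) {h : EuclideanSpace ℝ (Fin (m + 2)) → ENNReal}
    (hh : Measurable h) :
    ∫⁻ γ, h γ ∂uniformSphere (m + 1) =
      ∫⁻ α, ∫⁻ η : Sphere m, h (slice α η) ∂uniformSphere m ∂angleLaw m := by
  have hm : Measurable fun α : ℝ => ∫⁻ η : Sphere m, h (slice α η)
      ∂(volume : Measure (EuclideanSpace ℝ (Fin (m + 1)))).toSphere :=
    (hh.comp (measurable_slice.comp (f := fun p : ℝ × Sphere m =>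
      (p.1, (p.2 : EuclideanSpace ℝ (Fin (m + 1))))) (by fun_prop))).lintegral_prod_right'
  have h1 := lintegral_toSphere_eq_slice m (h := fun _ => 1) measurable_const
  simp only [lintegral_one] at h1
  rw [lintegral_mul_const _ (by fun_prop)] at h1
  simp_rw [lintegral_uniformSphere]
  rw [lintegral_const_mul _ hm, lintegral_angleLaw m hm, lintegral_toSphere_eq_slice m hh, h1,
    ENNReal.mul_inv (Or.inl (lintegral_sin_pow_ne_zero m))
      (Or.inl (lintegral_sin_pow_ne_top m))]
  ring

lemma ae_angleLaw_mem (m : ℕ) : ∀ᵐ α ∂angleLaw m, α ∈ Set.Ioo 0 Real.pi := by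
  refine Measure.ae_smul_measure ?_ _
  exact (withDensity_absolutelyContinuous _ _).ae_le (ae_restrict_mem measurableSet_Ioo)

/-- The law of the first two coordinates. -/
lemma map_coord_pair (m : ℕ) :
    (uniformSphere (m + 1)).map (fun γ : Sphere (m + 1) =>
        ((γ : EuclideanSpace ℝ (Fin (m + 2))) 0, (γ : EuclideanSpace ℝ (Fin (m + 2))) 1)) =
      ((angleLaw m).prod (projLaw m)).map
        (fun p => (Real.cos p.1, Real.sin p.1 * p.2)) := by
  refine Measure.ext_of_lintegral _ fun f hf => ?_
  rw [lintegral_map hf (by fun_prop), lintegral_map hf (by fun_prop),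
    lintegral_prod _ (by fun_prop),
    lintegral_uniformSphere_slice m (h := fun x => f (x 0, x 1)) (by fun_prop)]
  refine lintegral_congr fun α => ?_
  rw [lintegral_projLaw m (by fun_prop)]
  rfl

/-- The first coordinate of `slice α η` is cos α whatever the equatorial direction η. -/
lemma projLaw_eq_map_cos (m : ℕ) : projLaw (m + 1) = (angleLaw m).map Real.cos := by
  refine Measure.ext_of_lintegral _ fun f hf => ?_
  rw [lintegral_projLaw _ hf, lintegral_map hf (by fun_prop),
    lintegral_uniformSphere_slice m (h := fun x => f (x 0)) (by fun_prop)]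
  simp

/-- Two unit vectors at angle `θ` can be rotated into the coordinate plane. -/
lemma exists_isometry_of_inner_eq_cos (m : ℕ) {u v : EuclideanSpace ℝ (Fin (m + 2))}
    (hu : ‖u‖ = 1) (hv : ‖v‖ = 1) {θ : ℝ} (huv : ⟪u, v⟫ = Real.cos θ) :
    ∃ e : EuclideanSpace ℝ (Fin (m + 2)) ≃ₗᵢ[ℝ] EuclideanSpace ℝ (Fin (m + 2)),
      ∀ x, ⟪x, u⟫ = e x 0 ∧ ⟪x, v⟫ = Real.cos θ * e x 0 + Real.sin θ * e x 1 := by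
  have key : ∃ B : OrthonormalBasis (Fin (m + 2)) ℝ (EuclideanSpace ℝ (Fin (m + 2))),
      B 0 = u ∧ v = Real.cos θ • u + Real.sin θ • B 1 := by
    have hcard : Module.finrank ℝ (EuclideanSpace ℝ (Fin (m + 2))) = Fintype.card (Fin (m + 2)) := by
      simp
    have huu : ⟪u, u⟫ = 1 := by rw [real_inner_self_eq_norm_sq, hu, one_pow]
    have hvv : ⟪v, v⟫ = 1 := by rw [real_inner_self_eq_norm_sq, hv, one_pow]
    have hvu : ⟪v, u⟫ = Real.cos θ := by rw [real_inner_comm, huv]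
    have hsq := Real.sin_sq_add_cos_sq θ
    by_cases hs : Real.sin θ = 0
    -- If sin θ = 0 then v = ±u and no second direction is singled out; any orthonormal completion
    -- of u serves, as the coefficient of `B 1` vanishes.
    · have h0 : v - Real.cos θ • u = 0 := by
        rw [← inner_self_eq_zero (𝕜 := ℝ), inner_sub_left, inner_sub_right, inner_sub_right,
          inner_smul_left, inner_smul_left, inner_smul_right, inner_smul_right, huu, hvv, huv, hvu]
        simp only [conj_trivial]
        rw [hs] at hsq
        linarith
      have hon : Orthonormal ℝ (({0} : Set (Fin (m + 2))).domRestrict fun _ => u) := by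
        constructor
        · intro i; exact hu
        · intro i j hij; exact absurd (Subsingleton.elim i j) hij
      obtain ⟨B, hB⟩ := hon.exists_orthonormalBasis_extension_of_card_eq hcard
      refine ⟨B, hB 0 rfl, ?_⟩
      rw [hs, zero_smul, add_zero]
      exact sub_eq_zero.1 h0
    -- Gram–Schmidt: the component of v orthogonal to u has length |sin θ|.
    · set b := (Real.sin θ)⁻¹ • (v - Real.cos θ • u) with hb
      have hub : ⟪u, b⟫ = 0 := by
        rw [hb, inner_smul_right, inner_sub_right, inner_smul_right, huu, huv]; ring
      have hbb : ⟪b, b⟫ = 1 := by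
        rw [hb, inner_smul_right, inner_smul_left, inner_sub_left, inner_sub_right, inner_sub_right,
          inner_smul_left, inner_smul_left, inner_smul_right, inner_smul_right, huu, hvv, huv, hvu]
        simp only [conj_trivial]
        field_simp
        linarith
      have hbn : ‖b‖ = 1 := by
        rw [real_inner_self_eq_norm_sq] at hbb
        exact (pow_eq_one_iff_of_nonneg (norm_nonneg _) two_ne_zero).1 hbb
      have hon : Orthonormal ℝ (({0, 1} : Set (Fin (m + 2))).domRestrict
          fun i => if i = 0 then u else b) := by
        constructor
        · rintro ⟨i, hi⟩
          simp only [Set.domRestrict_apply]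
          split_ifs
          · exact hu
          · exact hbn
        · rintro ⟨i, hi⟩ ⟨j, hj⟩ hij
          simp only [Set.domRestrict_apply]
          have hne : i ≠ j := fun h => hij (by simpa using h)
          rcases hi with rfl | hi <;> rcases hj with rfl | hj
          · exact absurd rfl hne
          · obtain rfl : j = 1 := hj
            simpa using hub
          · obtain rfl : i = 1 := hi
            rw [real_inner_comm]
            simpa using hub
          · exact absurd (hi.trans hj.symm) hne
      obtain ⟨B, hB⟩ := hon.exists_orthonormalBasis_extension_of_card_eq hcard
      refine ⟨B, by simpa using hB 0 (by simp), ?_⟩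
      rw [hB 1 (by simp), if_neg (by simp), hb, smul_smul, mul_inv_cancel₀ hs, one_smul]
      abel
  obtain ⟨B, h0, hv⟩ := key
  refine ⟨B.repr, fun x => ?_⟩
  have e0 : B.repr x 0 = ⟪x, u⟫ := by rw [B.repr_apply_apply, h0, real_inner_comm]
  have e1 : B.repr x 1 = ⟪x, B 1⟫ := by rw [B.repr_apply_apply, real_inner_comm]
  rw [e0, e1]
  refine ⟨rfl, ?_⟩
  conv_lhs => rw [hv]
  rw [inner_add_right, inner_smul_right, inner_smul_right]

/-- The joint law of the projections on two unit vectors at angle `θ`, in coordinates. -/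
lemma map_inner_pair (m : ℕ) {u v : EuclideanSpace ℝ (Fin (m + 2))}
    (hu : ‖u‖ = 1) (hv : ‖v‖ = 1) {θ : ℝ} (huv : ⟪u, v⟫ = Real.cos θ) :
    (uniformSphere (m + 1)).map (fun γ : Sphere (m + 1) =>
        (⟪(γ : EuclideanSpace ℝ (Fin (m + 2))), u⟫, ⟪(γ : EuclideanSpace ℝ (Fin (m + 2))), v⟫)) =
      (uniformSphere (m + 1)).map (fun γ : Sphere (m + 1) =>
        ((γ : EuclideanSpace ℝ (Fin (m + 2))) 0,
          Real.cos θ * (γ : EuclideanSpace ℝ (Fin (m + 2))) 0 +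
            Real.sin θ * (γ : EuclideanSpace ℝ (Fin (m + 2))) 1)) := by
  obtain ⟨e, he⟩ := exists_isometry_of_inner_eq_cos m hu hv huv
  refine Measure.ext_of_lintegral _ fun f hf => ?_
  rw [lintegral_map hf (by fun_prop), lintegral_map hf (by fun_prop),
    ← lintegral_uniformSphere_isometry (m + 1) e (h := fun x =>
      f (x 0, Real.cos θ * x 0 + Real.sin θ * x 1)) (by fun_prop)]
  refine lintegral_congr fun γ => ?_
  rw [(he γ).1, (he γ).2]

/-- The projection on any unit vector has the law `projLaw`. -/
lemma map_inner (m : ℕ) {u : EuclideanSpace ℝ (Fin (m + 2))} (hu : ‖u‖ = 1) :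
    (uniformSphere (m + 1)).map (fun γ : Sphere (m + 1) =>
        ⟪(γ : EuclideanSpace ℝ (Fin (m + 2))), u⟫) = projLaw (m + 1) := by
  have h := map_inner_pair m hu hu (θ := 0)
    (by rw [real_inner_self_eq_norm_sq, hu, one_pow, Real.cos_zero])
  have h' := congrArg (Measure.map Prod.fst) h
  rwa [Measure.map_map measurable_fst (by fun_prop),
    Measure.map_map measurable_fst (by fun_prop)] at h'

lemma projLaw_map_neg (q : ℕ) : (projLaw q).map (fun t => -t) = projLaw q := by
  refine Measure.ext_of_lintegral _ fun f hf => ?_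
  rw [lintegral_map hf (by fun_prop), lintegral_projLaw q (by fun_prop), lintegral_projLaw q hf,
    ← lintegral_uniformSphere_isometry q (LinearIsometryEquiv.neg ℝ)
      (h := fun x => f (x 0)) (by fun_prop)]
  rfl

/-- The zero-dimensional sphere is {1, -1}, where f(t) + f(-t) is constant; symmetry of the law
gives both terms the same integral. -/
lemma lintegral_projLaw_zero {f : ℝ → ENNReal} (hf : Measurable f) :
    ∫⁻ t, f t ∂projLaw 0 = 2⁻¹ * (f 1 + f (-1)) := by
  have h1 : ∫⁻ t, f (-t) ∂projLaw 0 = ∫⁻ t, f t ∂projLaw 0 := by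
    conv_rhs => rw [← projLaw_map_neg 0, lintegral_map hf (by fun_prop)]
  have h2 : ∫⁻ t, (f t + f (-t)) ∂projLaw 0 = f 1 + f (-1) := by
    rw [lintegral_projLaw 0 (by fun_prop)]
    have : ∀ γ : Sphere 0, f ((γ : EuclideanSpace ℝ (Fin 1)) 0) +
        f (-(γ : EuclideanSpace ℝ (Fin 1)) 0) = f 1 + f (-1) := by
      intro γ
      have h := norm_eq_of_mem_sphere γ
      rw [EuclideanSpace.norm_eq, Real.sqrt_eq_one] at h
      rw [show ∑ i, ‖(γ : EuclideanSpace ℝ (Fin (0 + 1))) i‖ ^ 2 =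
        ‖(γ : EuclideanSpace ℝ (Fin (0 + 1))) 0‖ ^ 2 from Fin.sum_univ_one _, Real.norm_eq_abs,
        sq_abs] at h
      rcases sq_eq_one_iff.1 h with h | h
      · rw [h]
      · rw [h, neg_neg, add_comm]
    simp_rw [this]
    simp
  rw [lintegral_add_left hf, h1, ← two_mul] at h2
  rw [← h2, ← mul_assoc, ENNReal.inv_mul_cancel (by simp) (by simp), one_mul]

/-- The direction of the first two coordinates is uniform on the circle. -/
lemma lintegral_uniformSphere_homogeneous (m : ℕ) {f : ℝ × ℝ → ENNReal} (hf : Measurable f)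
    (hhom : m = 0 ∨ ∀ r > 0, ∀ x y, f (r * x, r * y) = f (x, y)) :
    ∫⁻ γ : Sphere (m + 1), f ((γ : EuclideanSpace ℝ (Fin (m + 2))) 0,
        (γ : EuclideanSpace ℝ (Fin (m + 2))) 1) ∂uniformSphere (m + 1) =
      (ENNReal.ofReal (2 * Real.pi))⁻¹ *
        ∫⁻ φ in Set.Ioo (-Real.pi) Real.pi, f (Real.cos φ, Real.sin φ) := by
  induction m with
  | zero =>
    have h := lintegral_map (μ := uniformSphere 1) hf
      (g := fun γ : Sphere 1 => ((γ : EuclideanSpace ℝ (Fin 2)) 0,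
        (γ : EuclideanSpace ℝ (Fin 2)) 1)) (by fun_prop)
    rw [← h, map_coord_pair 0, lintegral_map hf (by fun_prop), lintegral_prod _ (by fun_prop)]
    simp_rw [fun α : ℝ => lintegral_projLaw_zero
      (by fun_prop : Measurable fun t => f (Real.cos α, Real.sin α * t))]
    -- On the circle slicing gives (cos α, ± sin α) with equal weights; the minus sign is the lower
    -- half circle, traversed by α ↦ -α.
    have hneg : ∫⁻ α in Set.Ioo 0 Real.pi, f (Real.cos α, -Real.sin α) =
        ∫⁻ α in Set.Ioo (-Real.pi) 0, f (Real.cos α, Real.sin α) := by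
      have := (Measure.measurePreserving_neg (volume : Measure ℝ)).setLIntegral_comp_preimage
        (s := Set.Ioo (-Real.pi) 0) measurableSet_Ioo
        (f := fun α => f (Real.cos α, Real.sin α)) (by fun_prop)
      rw [← this]
      simp
    have hsplit : ∫⁻ φ in Set.Ioo (-Real.pi) Real.pi, f (Real.cos φ, Real.sin φ) =
        (∫⁻ φ in Set.Ioo (-Real.pi) 0, f (Real.cos φ, Real.sin φ)) +
          ∫⁻ φ in Set.Ioo 0 Real.pi, f (Real.cos φ, Real.sin φ) := by
      rw [← setLIntegral_congr (Ioo_ae_eq_Ioc (μ := volume) (a := -Real.pi) (b := 0)).symm,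
        ← lintegral_union measurableSet_Ioo,
        Set.Ioc_union_Ioo_eq_Ioo (by linarith [Real.pi_pos]) Real.pi_pos]
      exact Set.disjoint_left.2 fun x hx hx' => absurd hx.2 (not_le.2 hx'.1)
    rw [lintegral_const_mul _ (by fun_prop), lintegral_angleLaw 0 (by fun_prop)]
    simp only [pow_zero, ENNReal.ofReal_one, mul_one, one_mul, lintegral_one,
      Measure.restrict_apply MeasurableSet.univ, Set.univ_inter, Real.volume_Ioo, sub_zero, mul_neg]
    rw [lintegral_add_left (by fun_prop), hneg, hsplit, ENNReal.ofReal_mul zero_le_two,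
      ENNReal.mul_inv (by simp) (by simp), mul_assoc, add_comm]
    simp
  | succ m ih =>
    have hhom : ∀ r > 0, ∀ x y, f (r * x, r * y) = f (x, y) := by
      rcases hhom with h | h
      · omega
      · exact h
    -- By rotation, coordinates (1, 2) have the joint law of coordinates (0, 1). Slicing along
    -- coordinate 0 gives the former the common factor sin α > 0, which homogeneity of f removes.
    have h1 := map_inner_pair (m + 1) (u := EuclideanSpace.single 1 1)
      (v := EuclideanSpace.single 2 1) (θ := Real.pi / 2) (by simp) (by simp) (by
        have : (1 : Fin (m + 1 + 2)) ≠ 2 := by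
          refine Fin.ne_of_val_ne ?_
          rw [Fin.val_one, Fin.coe_ofNat_eq_mod, Nat.mod_eq_of_lt (by omega)]
          norm_num
        simp [EuclideanSpace.inner_single_left, this])
    have h2 := congrArg (fun μ : Measure (ℝ × ℝ) => ∫⁻ p, f p ∂μ) h1
    simp only [Real.cos_pi_div_two, Real.sin_pi_div_two, zero_mul, zero_add, one_mul,
      EuclideanSpace.inner_single_right, conj_trivial] at h2
    rw [lintegral_map hf (by fun_prop), lintegral_map hf (by fun_prop)] at h2
    rw [← ih (Or.inr hhom), ← h2,
      lintegral_uniformSphere_slice (m + 1) (h := fun x => f (x 1, x 2)) (by fun_prop)]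
    have : ∀ᵐ α ∂angleLaw (m + 1), ∫⁻ η : Sphere (m + 1),
        f ((slice α (η : EuclideanSpace ℝ (Fin (m + 2)))) 1,
          (slice α (η : EuclideanSpace ℝ (Fin (m + 2)))) 2) ∂uniformSphere (m + 1) =
        ∫⁻ η : Sphere (m + 1), f ((η : EuclideanSpace ℝ (Fin (m + 2))) 0,
          (η : EuclideanSpace ℝ (Fin (m + 2))) 1) ∂uniformSphere (m + 1) := by
      filter_upwards [ae_angleLaw_mem (m + 1)] with α hα
      refine lintegral_congr fun η => ?_
      exact hhom _ (Real.sin_pos_of_pos_of_lt_pi hα.1 hα.2) _ _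
    rw [lintegral_congr_ae this]
    simp

/-! ### The projected uniform distribution in terms of the polar angle -/

/-- The normalizing constant `∫₀^π sin ^ m` of the polar angle density. -/
noncomputable def sinInt (m : ℕ) : ℝ := ∫ α in (0 : ℝ)..Real.pi, Real.sin α ^ m

lemma sinInt_pos (m : ℕ) : 0 < sinInt m := integral_sin_pow_pos m

lemma toReal_lintegral_sin_pow (m : ℕ) :
    (∫⁻ α in Set.Ioo 0 Real.pi, ENNReal.ofReal (Real.sin α ^ m)).toReal = sinInt m := by
  rw [sinInt, intervalIntegral.integral_of_le Real.pi_pos.le, integral_Ioc_eq_integral_Ioo,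
    integral_eq_lintegral_of_nonneg_ae _ (by fun_prop)]
  filter_upwards [ae_restrict_mem measurableSet_Ioo] with α hα
  exact pow_nonneg (Real.sin_pos_of_pos_of_lt_pi hα.1 hα.2).le m

lemma integral_angleLaw (m : ℕ) (g : ℝ → ℝ) :
    ∫ α, g α ∂angleLaw m = (sinInt m)⁻¹ * ∫ α in Set.Ioo 0 Real.pi, Real.sin α ^ m * g α := by
  rw [angleLaw, integral_smul_measure, ENNReal.toReal_inv, toReal_lintegral_sin_pow,
    integral_withDensity_eq_integral_toReal_smul (by fun_prop) (by simp), smul_eq_mul]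
  congr 1
  refine setIntegral_congr_fun measurableSet_Ioo fun α hα => ?_
  simp only [smul_eq_mul]
  rw [ENNReal.toReal_ofReal (pow_nonneg (Real.sin_pos_of_pos_of_lt_pi hα.1 hα.2).le m)]

lemma integral_projLaw (m : ℕ) {g : ℝ → ℝ} (hg : Measurable g) :
    ∫ t, g t ∂projLaw (m + 1) = ∫ α, g (Real.cos α) ∂angleLaw m := by
  rw [projLaw_eq_map_cos, integral_map (by fun_prop) hg.aestronglyMeasurable]

lemma angleLaw_absolutelyContinuous (m : ℕ) : angleLaw m ≪ volume :=
  Measure.smul_absolutelyContinuous.trans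
    ((withDensity_absolutelyContinuous _ _).trans
      (Measure.absolutelyContinuous_of_le Measure.restrict_le_self))

lemma ae_projLaw_mem (m : ℕ) : ∀ᵐ t ∂projLaw (m + 1), t ∈ Set.Ioo (-1 : ℝ) 1 := by
  rw [projLaw_eq_map_cos]
  refine (ae_map_iff (by fun_prop) measurableSet_Ioo).2 ?_
  filter_upwards [ae_angleLaw_mem m] with α hα
  constructor
  · rw [← Real.cos_pi]
    exact Real.strictAntiOn_cos ⟨hα.1.le, hα.2.le⟩ ⟨Real.pi_pos.le, le_rfl⟩ hα.2
  · rw [← Real.cos_zero]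
    exact Real.strictAntiOn_cos ⟨le_rfl, Real.pi_pos.le⟩ ⟨hα.1.le, hα.2.le⟩ hα.1

/-- The polar angle has a density and cosine is injective on [0, π]. Absence of atoms makes ties
between projections and the choice of open or closed half lines irrelevant below; it fails for
`projLaw 0`. -/
instance (m : ℕ) : NullSingletonClass (projLaw (m + 1)) := by
  constructor
  intro x
  rw [projLaw_eq_map_cos, Measure.map_apply (by fun_prop) (measurableSet_singleton x)]
  have h : (angleLaw m) (Real.cos ⁻¹' {x} ∩ Set.Ioo 0 Real.pi) = 0 := by
    refine angleLaw_absolutelyContinuous m (Set.Subsingleton.measure_zero ?_ _)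
    intro a ha b hb
    exact Real.injOn_cos ⟨ha.2.1.le, ha.2.2.le⟩ ⟨hb.2.1.le, hb.2.2.le⟩ (ha.1.trans hb.1.symm)
  refine (measure_congr ?_).trans h
  filter_upwards [ae_angleLaw_mem m] with α hα
  exact propext ⟨fun h => ⟨h, hα⟩, fun h => h.1⟩

/-- Integration against the projected uniform distribution, substituting `t = cos α`. -/
lemma setIntegral_projLaw (m : ℕ) {g : ℝ → ℝ} (hg : Measurable g) {a b : ℝ} (ha : 0 ≤ a)
    (hab : a ≤ b) (hb : b ≤ Real.pi) :
    ∫ t in Set.Ioc (Real.cos b) (Real.cos a), g t ∂projLaw (m + 1) =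
      (sinInt m)⁻¹ * ∫ α in a..b, Real.sin α ^ m * g (Real.cos α) := by
  rw [← integral_indicator measurableSet_Ioc, integral_projLaw m (hg.indicator measurableSet_Ioc),
    integral_angleLaw, intervalIntegral.integral_of_le hab]
  congr 1
  have h1 : ∫ α in Set.Ioo 0 Real.pi, Real.sin α ^ m *
        Set.indicator (Set.Ioc (Real.cos b) (Real.cos a)) g (Real.cos α) =
      ∫ α in Set.Ioo 0 Real.pi,
        Set.indicator (Set.Ico a b) (fun α => Real.sin α ^ m * g (Real.cos α)) α := by
    refine setIntegral_congr_fun measurableSet_Ioo fun α hα => ?_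
    have hα' : α ∈ Set.Icc 0 Real.pi := ⟨hα.1.le, hα.2.le⟩
    have : Real.cos α ∈ Set.Ioc (Real.cos b) (Real.cos a) ↔ α ∈ Set.Ico a b := by
      rw [Set.mem_Ioc, Set.mem_Ico,
        Real.strictAntiOn_cos.lt_iff_gt ⟨ha.trans hab, hb⟩ hα',
        Real.strictAntiOn_cos.le_iff_ge hα' ⟨ha, hab.trans hb⟩, and_comm]
    by_cases h : α ∈ Set.Ico a b
    · simp only [Set.indicator_of_mem h, Set.indicator_of_mem (this.2 h)]
    · simp only [Set.indicator_of_notMem h, Set.indicator_of_notMem (fun h' => h (this.1 h')),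
        mul_zero]
  rw [h1, setIntegral_indicator measurableSet_Ico]
  refine setIntegral_congr_set ?_
  refine (Ioo_ae_eq_Icc.inter Ico_ae_eq_Icc).trans ?_
  rw [Set.inter_eq_right.2 (Set.Icc_subset_Icc ha hb)]
  exact Ioc_ae_eq_Icc.symm

lemma F_eq (q : ℕ) (x : ℝ) : F q x = (projLaw q).real (Set.Iic x) := cdf_eq_real _ _

lemma F_nonneg (q : ℕ) (x : ℝ) : 0 ≤ F q x := cdf_nonneg _ _

lemma F_le_one (q : ℕ) (x : ℝ) : F q x ≤ 1 := cdf_le_one _ _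

@[simp] lemma measure_F (q : ℕ) : (F q).measure = projLaw q := measure_cdf _

@[fun_prop] lemma measurable_F (q : ℕ) : Measurable (F q) := (F q).mono.measurable

lemma compF_cvmCdf (q : ℕ) : compF cvmCdf q = F q := by
  refine StieltjesFunction.ext fun x => ?_
  change max 0 (min (F q x) 1) = F q x
  rw [min_eq_left (F_le_one q x), max_eq_right (F_nonneg q x)]

/-- Removes the restriction to [-1, 1] from the definitions of `P` and `psi`: dF_q charges only (-1,
1). -/
lemma restrict_compF_cvmCdf (m : ℕ) :
    (compF cvmCdf (m + 1)).measure.restrict (Set.Icc (-1) 1) = projLaw (m + 1) := by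
  rw [compF_cvmCdf, measure_F]
  refine Measure.restrict_eq_self_of_ae_mem ?_
  filter_upwards [ae_projLaw_mem m] with t ht using ⟨ht.1.le, ht.2.le⟩

/-- `F_q` in terms of the polar angle, for `q = m + 1`. -/
noncomputable def polarCdf (m : ℕ) (α : ℝ) : ℝ :=
  (sinInt m)⁻¹ * ∫ x in α..Real.pi, Real.sin x ^ m

lemma F_cos (m : ℕ) {α : ℝ} (h0 : 0 ≤ α) (hπ : α ≤ Real.pi) :
    F (m + 1) (Real.cos α) = polarCdf m α := by
  have h := setIntegral_projLaw m (g := fun _ => 1) measurable_const h0 hπ le_rfl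
  simp only [mul_one] at h
  rw [polarCdf, ← h, setIntegral_const, smul_eq_mul, mul_one, F_eq]
  refine measureReal_congr ?_
  filter_upwards [ae_projLaw_mem m] with t ht
  refine propext ⟨fun h => ⟨?_, h⟩, fun h => h.2⟩
  rw [Real.cos_pi]
  exact ht.1

lemma hasDerivAt_polarCdf (m : ℕ) (α : ℝ) :
    HasDerivAt (polarCdf m) (-((sinInt m)⁻¹ * Real.sin α ^ m)) α := by
  have hc : Continuous fun x => Real.sin x ^ m := by fun_prop
  have := (intervalIntegral.integral_hasDerivAt_left (hc.intervalIntegrable α Real.pi)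
    (hc.stronglyMeasurableAtFilter _ _) hc.continuousAt).const_mul
      ((sinInt m)⁻¹)
  rwa [mul_neg] at this

lemma continuous_polarCdf (m : ℕ) : Continuous (polarCdf m) :=
  continuous_iff_continuousAt.2 fun α => (hasDerivAt_polarCdf m α).continuousAt

@[simp] lemma polarCdf_pi (m : ℕ) : polarCdf m Real.pi = 0 := by simp [polarCdf]

@[simp] lemma polarCdf_zero (m : ℕ) : polarCdf m 0 = 1 :=
  inv_mul_cancel₀ (sinInt_pos m).ne'

/-- Symmetry of the law together with the absence of an atom at t. -/
lemma F_neg (m : ℕ) (t : ℝ) : F (m + 1) (-t) = 1 - F (m + 1) t := by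
  rw [F_eq, F_eq]
  have h1 : (projLaw (m + 1)).real (Set.Iic (-t)) = (projLaw (m + 1)).real (Set.Ici t) := by
    conv_lhs => rw [← projLaw_map_neg, map_measureReal_apply (by fun_prop) measurableSet_Iic]
    congr 1
    ext x
    simp
  have h2 := probReal_compl_eq_one_sub (μ := projLaw (m + 1)) (measurableSet_Iic (a := t))
  rw [h1, ← h2, Set.compl_Iic]
  exact measureReal_congr Ioi_ae_eq_Ici.symm

lemma F_zero (m : ℕ) : F (m + 1) 0 = 1 / 2 := by
  have := F_neg m 0
  rw [neg_zero] at this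
  linarith

lemma F_one (m : ℕ) : F (m + 1) 1 = 1 := by
  
  have := F_cos m le_rfl Real.pi_pos.le
  rwa [Real.cos_zero, polarCdf_zero] at this

lemma F_neg_one (m : ℕ) : F (m + 1) (-1) = 0 := by
  rw [F_neg, F_one, sub_self]

/-- The density of the polar angle is minus the derivative of `polarCdf`, so the integrand is an
exact derivative. This is the computation behind the uniformity of F_q(γ'u). -/
lemma integral_sin_pow_mul_polarCdf_pow (m k : ℕ) (a b : ℝ) :
    ∫ α in a..b, (sinInt m)⁻¹ * Real.sin α ^ m * polarCdf m α ^ k =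
      (polarCdf m a ^ (k + 1) - polarCdf m b ^ (k + 1)) / (k + 1) := by
  have hd : ∀ α, HasDerivAt (fun α => -(polarCdf m α ^ (k + 1) / (k + 1)))
      ((sinInt m)⁻¹ * Real.sin α ^ m * polarCdf m α ^ k) α := by
    intro α
    refine ((((hasDerivAt_polarCdf m α).pow (k + 1)).div_const ((k : ℝ) + 1)).neg).congr_deriv ?_
    have : (k : ℝ) + 1 ≠ 0 := by positivity
    push_cast
    field_simp
  have hc := continuous_polarCdf m
  rw [intervalIntegral.integral_eq_sub_of_hasDerivAt (fun α _ => hd α)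
    ((by fun_prop : Continuous fun α =>
      (sinInt m)⁻¹ * Real.sin α ^ m * polarCdf m α ^ k).intervalIntegrable _ _)]
  ring

/-- Powers of a cdf integrate as for the uniform distribution. -/
lemma setIntegral_Ioi_F_pow (m k : ℕ) {x : ℝ} (hx : x ∈ Set.Icc (-1 : ℝ) 1) :
    ∫ t in Set.Ioi x, F (m + 1) t ^ k ∂projLaw (m + 1) = (1 - F (m + 1) x ^ (k + 1)) / (k + 1) := by
  have hx' := Real.cos_arccos hx.1 hx.2
  have h0 := Real.arccos_nonneg x
  have h1 := Real.arccos_le_pi x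
  have hset : ∫ t in Set.Ioi x, F (m + 1) t ^ k ∂projLaw (m + 1) =
      ∫ t in Set.Ioc (Real.cos (Real.arccos x)) (Real.cos 0), F (m + 1) t ^ k
        ∂projLaw (m + 1) := by
    refine setIntegral_congr_set ?_
    filter_upwards [ae_projLaw_mem m] with t ht
    rw [hx', Real.cos_zero]
    exact propext ⟨fun h => ⟨h, ht.2.le⟩, fun h => h.1⟩
  rw [hset, setIntegral_projLaw m (by fun_prop) le_rfl h0 h1, ← intervalIntegral.integral_const_mul]
  have hint : ∀ α ∈ Set.uIcc 0 (Real.arccos x),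
      (sinInt m)⁻¹ * (Real.sin α ^ m * F (m + 1) (Real.cos α) ^ k) =
      (sinInt m)⁻¹ * Real.sin α ^ m * polarCdf m α ^ k := by
    intro α hα
    rw [Set.uIcc_of_le h0] at hα
    rw [F_cos m hα.1 (hα.2.trans h1), mul_assoc]
  rw [intervalIntegral.integral_congr hint, integral_sin_pow_mul_polarCdf_pow, polarCdf_zero,
    one_pow, ← F_cos m h0 h1, hx']

lemma integral_F_pow (m k : ℕ) :
    ∫ t, F (m + 1) t ^ k ∂projLaw (m + 1) = 1 / (k + 1) := by
  have h := setIntegral_Ioi_F_pow m k (x := -1) (by simp)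
  rw [F_neg_one, zero_pow (by omega), sub_zero] at h
  rw [← h, Measure.restrict_eq_self_of_ae_mem]
  filter_upwards [ae_projLaw_mem m] with t ht using ht.1

/-! ### The kernel `ψ` as an expectation, and the statistic as a double sum -/

lemma integrable_of_bounded {α : Type*} [MeasurableSpace α] {μ : Measure α} [IsFiniteMeasure μ]
    {f : α → ℝ} (hf : Measurable f) (C : ℝ) (hC : ∀ x, |f x| ≤ C) : Integrable f μ :=
  Integrable.of_bound hf.aestronglyMeasurable C (Filter.Eventually.of_forall hC)

/-- The common shape of the expanded squares in the projected statistic and in Watson's. -/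
lemma integral_mul_sub_mul_add {α : Type*} [MeasurableSpace α] {μ : Measure α} {f g h : α → ℝ}
    (hf : Integrable f μ) (hg : Integrable g μ) (hh : Integrable h μ) (a b : ℝ) :
    ∫ x, (a * f x - b * g x + h x) ∂μ = a * ∫ x, f x ∂μ - b * ∫ x, g x ∂μ + ∫ x, h x ∂μ := by
  rw [integral_add (f := fun x => a * f x - b * g x) ((hf.const_mul _).sub (hg.const_mul _)) hh,
    integral_sub (hf.const_mul _) (hg.const_mul _), integral_const_mul, integral_const_mul]

lemma abs_le_one_of_mem {x : ℝ} (h0 : 0 ≤ x) (h1 : x ≤ 1) : |x| ≤ 1 :=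
  abs_le.2 ⟨by linarith, h1⟩

lemma inner_mem_Icc {q : ℕ} (γ : Sphere q) {u : EuclideanSpace ℝ (Fin (q + 1))} (hu : ‖u‖ = 1) :
    ⟪(γ : EuclideanSpace ℝ (Fin (q + 1))), u⟫ ∈ Set.Icc (-1 : ℝ) 1 := by
  have := abs_real_inner_le_norm (γ : EuclideanSpace ℝ (Fin (q + 1))) u
  rw [hu, norm_eq_of_mem_sphere, one_mul] at this
  exact abs_le.1 this

lemma inner_dir (m : ℕ) (θ : ℝ) (x : EuclideanSpace ℝ (Fin (m + 2))) :
    ⟪x, dir (m + 1) θ⟫ = Real.cos θ * x 0 + Real.sin θ * x 1 := by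
  rw [PiLp.inner_apply, Fin.sum_univ_succ, Fin.sum_univ_succ]
  simp [dir]

lemma dir_apply_zero (m : ℕ) (θ : ℝ) : dir (m + 1) θ 0 = Real.cos θ := by simp [dir]

lemma dir_apply_one (m : ℕ) (θ : ℝ) : dir (m + 1) θ 1 = Real.sin θ := by simp [dir]

lemma inner_dir_dir (m : ℕ) (φ θ : ℝ) :
    ⟪dir (m + 1) φ, dir (m + 1) θ⟫ = Real.cos (θ - φ) := by
  rw [inner_dir, dir_apply_zero, dir_apply_one, Real.cos_sub]

lemma norm_dir (m : ℕ) (θ : ℝ) : ‖dir (m + 1) θ‖ = 1 := by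
  have h := inner_dir_dir m θ θ
  rw [real_inner_self_eq_norm_sq, sub_self, Real.cos_zero] at h
  exact (pow_eq_one_iff_of_nonneg (norm_nonneg _) two_ne_zero).1 h

/-- The joint law of the projections on two unit vectors depends only on their angle. -/
lemma map_inner_pair_congr (m : ℕ) {u v u' v' : EuclideanSpace ℝ (Fin (m + 2))}
    (hu : ‖u‖ = 1) (hv : ‖v‖ = 1) (hu' : ‖u'‖ = 1) (hv' : ‖v'‖ = 1) (h : ⟪u, v⟫ = ⟪u', v'⟫) :
    (uniformSphere (m + 1)).map (fun γ : Sphere (m + 1) =>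
        (⟪(γ : EuclideanSpace ℝ (Fin (m + 2))), u⟫, ⟪(γ : EuclideanSpace ℝ (Fin (m + 2))), v⟫)) =
      (uniformSphere (m + 1)).map (fun γ : Sphere (m + 1) =>
        (⟪(γ : EuclideanSpace ℝ (Fin (m + 2))), u'⟫,
          ⟪(γ : EuclideanSpace ℝ (Fin (m + 2))), v'⟫)) := by
  have habs := abs_le.1 (abs_real_inner_le_norm u v)
  rw [hu, hv, one_mul] at habs
  have hc := Real.cos_arccos habs.1 habs.2
  rw [map_inner_pair m hu hv hc.symm, map_inner_pair m hu' hv' (h.symm.trans hc.symm)]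

lemma integral_inner_pair_congr (m : ℕ) {u v u' v' : EuclideanSpace ℝ (Fin (m + 2))}
    (hu : ‖u‖ = 1) (hv : ‖v‖ = 1) (hu' : ‖u'‖ = 1) (hv' : ‖v'‖ = 1) (h : ⟪u, v⟫ = ⟪u', v'⟫)
    {g : ℝ × ℝ → ℝ} (hg : Measurable g) :
    ∫ γ : Sphere (m + 1), g (⟪(γ : EuclideanSpace ℝ (Fin (m + 2))), u⟫,
        ⟪(γ : EuclideanSpace ℝ (Fin (m + 2))), v⟫) ∂uniformSphere (m + 1) =
      ∫ γ : Sphere (m + 1), g (⟪(γ : EuclideanSpace ℝ (Fin (m + 2))), u'⟫,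
        ⟪(γ : EuclideanSpace ℝ (Fin (m + 2))), v'⟫) ∂uniformSphere (m + 1) := by
  have := congrArg (fun μ : Measure (ℝ × ℝ) => ∫ p, g p ∂μ)
    (map_inner_pair_congr m hu hv hu' hv' h)
  beta_reduce at this
  rwa [integral_map (by fun_prop) hg.aestronglyMeasurable,
    integral_map (by fun_prop) hg.aestronglyMeasurable] at this

lemma integral_inner (m : ℕ) {u : EuclideanSpace ℝ (Fin (m + 2))} (hu : ‖u‖ = 1)
    {g : ℝ → ℝ} (hg : Measurable g) :
    ∫ γ : Sphere (m + 1), g ⟪(γ : EuclideanSpace ℝ (Fin (m + 2))), u⟫ ∂uniformSphere (m + 1) =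
      ∫ t, g t ∂projLaw (m + 1) := by
  rw [← map_inner m hu, integral_map (by fun_prop) hg.aestronglyMeasurable]

/-- Frees `A` from the fixed pair of directions in its definition and merges the two conditions into
one on the maximum, ready for Fubini. -/
lemma A_eq (m : ℕ) {u v : EuclideanSpace ℝ (Fin (m + 2))} (hu : ‖u‖ = 1) (hv : ‖v‖ = 1) {θ : ℝ}
    (huv : ⟪u, v⟫ = Real.cos θ) (x : ℝ) :
    A (m + 1) θ x = ∫ γ : Sphere (m + 1),
      (if max ⟪(γ : EuclideanSpace ℝ (Fin (m + 2))), u⟫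
        ⟪(γ : EuclideanSpace ℝ (Fin (m + 2))), v⟫ ≤ x then (1 : ℝ) else 0)
      ∂uniformSphere (m + 1) := by
  have h := integral_inner_pair_congr m hu hv (norm_dir m 0) (norm_dir m θ)
    (by rw [huv, inner_dir_dir, sub_zero])
    (g := fun p => if max p.1 p.2 ≤ x then (1 : ℝ) else 0)
    (Measurable.ite (measurableSet_le (by fun_prop) (by fun_prop)) (by fun_prop) (by fun_prop))
  rw [h, A]
  have hS : MeasurableSet {γ : Sphere (m + 1) |
      ⟪(γ : EuclideanSpace ℝ (Fin (m + 2))), dir (m + 1) 0⟫ ≤ x ∧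
        ⟪(γ : EuclideanSpace ℝ (Fin (m + 2))), dir (m + 1) θ⟫ ≤ x} := by
    have h1 : ∀ φ, MeasurableSet {γ : Sphere (m + 1) |
        ⟪(γ : EuclideanSpace ℝ (Fin (m + 2))), dir (m + 1) φ⟫ ≤ x} := fun φ =>
      measurableSet_le (by fun_prop) (by fun_prop)
    exact (h1 0).inter (h1 θ)
  rw [← integral_indicator_one hS]
  refine integral_congr_ae (Filter.Eventually.of_forall fun γ => ?_)
  simp only [Set.indicator, Set.mem_ofPred_eq, max_le_iff, Pi.one_apply]

lemma integral_ite_le_mul_F_pow (m k : ℕ) {y : ℝ} (hy : y ∈ Set.Icc (-1 : ℝ) 1) :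
    ∫ x, (if y ≤ x then (1 : ℝ) else 0) * F (m + 1) x ^ k ∂projLaw (m + 1) =
      (1 - F (m + 1) y ^ (k + 1)) / (k + 1) := by
  rw [← setIntegral_Ioi_F_pow m k hy, restrict_Ioi_eq_restrict_Ici,
    ← integral_indicator measurableSet_Ici]
  refine integral_congr_ae (Filter.Eventually.of_forall fun x => ?_)
  by_cases h : y ≤ x
  · simp [h]
  · simp [h]

lemma integral_ite_le (m : ℕ) {y : ℝ} (hy : y ∈ Set.Icc (-1 : ℝ) 1) :
    ∫ x, (if y ≤ x then (1 : ℝ) else 0) ∂projLaw (m + 1) = 1 - F (m + 1) y := by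
  simpa using integral_ite_le_mul_F_pow m 0 hy

/-- The kernel in terms of the larger of the two projections. -/
lemma psi_eq (m : ℕ) {u v : EuclideanSpace ℝ (Fin (m + 2))} (hu : ‖u‖ = 1) (hv : ‖v‖ = 1) {θ : ℝ}
    (huv : ⟪u, v⟫ = Real.cos θ) :
    psi cvmCdf (m + 1) θ = ∫ γ : Sphere (m + 1),
      (1 - F (m + 1) (max ⟪(γ : EuclideanSpace ℝ (Fin (m + 2))), u⟫
        ⟪(γ : EuclideanSpace ℝ (Fin (m + 2))), v⟫)) ∂uniformSphere (m + 1) := by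
  rw [psi, restrict_compF_cvmCdf]
  simp_rw [A_eq m hu hv huv]
  -- With x integrated first, only the dF_q-mass above the larger projection remains.
  rw [integral_integral_swap]
  · refine integral_congr_ae (Filter.Eventually.of_forall fun γ => ?_)
    have h1 := inner_mem_Icc γ hu
    have h2 := inner_mem_Icc γ hv
    exact integral_ite_le m ⟨le_max_of_le_left h1.1, max_le h1.2 h2.2⟩
  · refine integrable_of_bounded (Measurable.ite (measurableSet_le ?_ ?_) ?_ ?_) 1 ?_
    any_goals fun_prop
    intro p
    simp only [Function.uncurry]
    split_ifs <;> simp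

lemma norm_coe_sphere {q : ℕ} (u : Sphere q) : ‖(u : EuclideanSpace ℝ (Fin (q + 1)))‖ = 1 :=
  norm_eq_of_mem_sphere u

lemma cos_angle {q : ℕ} (u v : Sphere q) :
    ⟪(u : EuclideanSpace ℝ (Fin (q + 1))), (v : EuclideanSpace ℝ (Fin (q + 1)))⟫ =
      Real.cos (angle u v) := by
  have := inner_mem_Icc u (norm_coe_sphere v)
  rw [angle, Real.cos_arccos this.1 this.2]

lemma angle_comm {q : ℕ} (u v : Sphere q) : angle u v = angle v u := by
  rw [angle, angle, real_inner_comm]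

lemma angle_self {q : ℕ} (u : Sphere q) : angle u u = 0 := by
  rw [angle, real_inner_self_eq_norm_sq, norm_coe_sphere, one_pow, Real.arccos_one]

lemma angle_mem {q : ℕ} (u v : Sphere q) : angle u v ∈ Set.Icc 0 Real.pi :=
  ⟨Real.arccos_nonneg _, Real.arccos_le_pi _⟩

/-- At angle 0 the maximum is a single projection, and U = F_q(γ'u) is uniform, so E[1 - U] = 1/2.
-/
lemma psi_zero (m : ℕ) : psi cvmCdf (m + 1) 0 = 1 / 2 := by
  have hd := norm_dir m 0
  rw [psi_eq m hd hd (by rw [inner_dir_dir, sub_self])]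
  simp only [max_self]
  rw [integral_inner m hd (g := fun t => 1 - F (m + 1) t) (by fun_prop),
    integral_sub (integrable_const _) (integrable_of_bounded (by fun_prop) 1 fun x =>
      abs_le_one_of_mem (F_nonneg _ x) (F_le_one _ x))]
  have := integral_F_pow m 1
  simp only [pow_one] at this
  rw [this]
  norm_num

/-- The projected statistic as a double sum of the kernel. -/
lemma P_eq_double_sum (m : ℕ) {n : ℕ} (hn : 1 ≤ n) (X : Fin n → Sphere (m + 1)) :
    P cvmCdf (m + 1) X =
      (n : ℝ)⁻¹ * (∑ i, ∑ j, psi cvmCdf (m + 1) (angle (X i) (X j))) - n / 3 := by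
  have hn0 : (n : ℝ) ≠ 0 := by positivity
  set G : Fin n → Sphere (m + 1) → ℝ := fun i γ =>
    ⟪(γ : EuclideanSpace ℝ (Fin (m + 2))), (X i : EuclideanSpace ℝ (Fin (m + 2)))⟫ with hG
  have hGm : ∀ i, Measurable (G i) := fun i => by simp only [hG]; fun_prop
  have hGI : ∀ i γ, G i γ ∈ Set.Icc (-1 : ℝ) 1 := fun i γ => inner_mem_Icc γ (norm_coe_sphere _)
  have hFm := measurable_F (m + 1)
  have hF0 := F_nonneg (m + 1)
  have hF1 := F_le_one (m + 1)
  have hind : ∀ a : ℝ, Measurable fun x : ℝ => if a ≤ x then (1 : ℝ) else 0 := fun a =>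
    Measurable.ite (measurableSet_le (by fun_prop) (by fun_prop)) (by fun_prop) (by fun_prop)
  have hind0 : ∀ a x : ℝ, 0 ≤ (if a ≤ x then (1 : ℝ) else 0) := fun a x => by
    split_ifs <;> norm_num
  have hind1 : ∀ a x : ℝ, (if a ≤ x then (1 : ℝ) else 0) ≤ 1 := fun a x => by
    split_ifs <;> norm_num
  have inner_int : ∀ γ : Sphere (m + 1),
      ∫ x, (projEcdf X γ x - F (m + 1) x) ^ 2 ∂projLaw (m + 1) =
        (n : ℝ)⁻¹ ^ 2 * (∑ i, ∑ j, (1 - F (m + 1) (max (G i γ) (G j γ)))) -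
          (n : ℝ)⁻¹ * (∑ i, (1 - F (m + 1) (G i γ) ^ 2)) + 1 / 3 := by
    intro γ
    -- A product of two threshold indicators is the indicator for the maximum. The exponent 1 on `F`
    -- is kept so that `integral_ite_le_mul_F_pow` applies.
    have hexp : ∀ x, (projEcdf X γ x - F (m + 1) x) ^ 2 =
        (n : ℝ)⁻¹ ^ 2 * (∑ i, ∑ j, if max (G i γ) (G j γ) ≤ x then (1 : ℝ) else 0) -
          (n : ℝ)⁻¹ * (∑ i, 2 * ((if G i γ ≤ x then (1 : ℝ) else 0) * F (m + 1) x ^ 1)) +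
          F (m + 1) x ^ 2 := by
      intro x
      have h1 : (∑ i, ∑ j, if max (G i γ) (G j γ) ≤ x then (1 : ℝ) else 0) =
          (∑ i, if G i γ ≤ x then (1 : ℝ) else 0) ^ 2 := by
        rw [sq, Finset.sum_mul_sum]
        refine Finset.sum_congr rfl fun i _ => Finset.sum_congr rfl fun j _ => ?_
        simp only [max_le_iff, ite_zero_mul_ite_zero, one_mul]
      rw [h1, ← Finset.mul_sum, ← Finset.sum_mul, projEcdf]
      ring
    simp_rw [hexp]
    have hi1 : ∀ i j, Integrable (fun x => if max (G i γ) (G j γ) ≤ x then (1 : ℝ) else 0)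
        (projLaw (m + 1)) := fun i j => integrable_of_bounded (hind _) 1 fun x =>
      abs_le_one_of_mem (hind0 _ x) (hind1 _ x)
    have hi2 : ∀ i, Integrable (fun x => 2 * ((if G i γ ≤ x then (1 : ℝ) else 0) *
        F (m + 1) x ^ 1)) (projLaw (m + 1)) := fun i =>
      (integrable_of_bounded ((hind _).mul (hFm.pow_const 1)) 1 fun x =>
        abs_le_one_of_mem (mul_nonneg (hind0 _ x) (pow_nonneg (hF0 x) 1))
          (mul_le_one₀ (hind1 _ x) (pow_nonneg (hF0 x) 1) (pow_le_one₀ (hF0 x) (hF1 x)))).const_mul 2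
    have hi3 : Integrable (fun x => F (m + 1) x ^ 2) (projLaw (m + 1)) :=
      integrable_of_bounded (hFm.pow_const 2) 1 fun x =>
        abs_le_one_of_mem (pow_nonneg (hF0 x) 2) (pow_le_one₀ (hF0 x) (hF1 x))
    have hs1 := integrable_finsetSum Finset.univ fun i _ =>
      integrable_finsetSum Finset.univ fun j _ => hi1 i j
    have hs2 := integrable_finsetSum Finset.univ fun i _ => hi2 i
    rw [integral_mul_sub_mul_add hs1 hs2 hi3,
      integral_finsetSum _ fun i _ => integrable_finsetSum Finset.univ fun j _ => hi1 i j,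
      integral_finsetSum _ fun i _ => hi2 i, integral_F_pow]
    congr 1
    · congr 2
      · refine Finset.sum_congr rfl fun i _ => ?_
        rw [integral_finsetSum _ fun j _ => hi1 i j]
        refine Finset.sum_congr rfl fun j _ => ?_
        exact integral_ite_le m ⟨le_max_of_le_left (hGI i γ).1, max_le (hGI i γ).2 (hGI j γ).2⟩
      · refine Finset.sum_congr rfl fun i _ => ?_
        rw [integral_const_mul, integral_ite_le_mul_F_pow m 1 (hGI i γ)]
        push_cast
        ring
    · norm_num
  have hj1 : ∀ i j, Integrable (fun γ => 1 - F (m + 1) (max (G i γ) (G j γ)))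
      (uniformSphere (m + 1)) := fun i j =>
    integrable_of_bounded (measurable_const.sub (hFm.comp ((hGm i).max (hGm j)))) 1 fun γ =>
      abs_le_one_of_mem (by linarith [hF1 (max (G i γ) (G j γ))])
        (by linarith [hF0 (max (G i γ) (G j γ))])
  have hj2' : ∀ i, Integrable (fun γ => F (m + 1) (G i γ) ^ 2) (uniformSphere (m + 1)) := fun i =>
    integrable_of_bounded ((hFm.comp (hGm i)).pow_const 2) 1 fun γ =>
      abs_le_one_of_mem (pow_nonneg (hF0 _) 2) (pow_le_one₀ (hF0 _) (hF1 _))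
  have hj2 : ∀ i, Integrable (fun γ => 1 - F (m + 1) (G i γ) ^ 2) (uniformSphere (m + 1)) :=
    fun i => (integrable_const _).sub (hj2' i)
  have hs1 := integrable_finsetSum Finset.univ fun i _ =>
    integrable_finsetSum Finset.univ fun j _ => hj1 i j
  have hs2 := integrable_finsetSum Finset.univ fun i _ => hj2 i
  rw [P, restrict_compF_cvmCdf]
  simp_rw [inner_int]
  rw [integral_mul_sub_mul_add hs1 hs2 (integrable_const _),
    integral_finsetSum _ fun i _ => integrable_finsetSum Finset.univ fun j _ => hj1 i j,
    integral_finsetSum _ fun i _ => hj2 i]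
  -- This is 1 - E[U²] for U uniform. After scaling by n, the cross term gives -2n/3 and the squared
  -- cdf gives n/3, hence -n/3 in total.
  have e1 : ∀ i, ∫ γ, (1 - F (m + 1) (G i γ) ^ 2) ∂uniformSphere (m + 1) = 2 / 3 := by
    intro i
    rw [integral_sub (integrable_const _) (hj2' i),
      integral_inner m (norm_coe_sphere (X i)) (g := fun t => F (m + 1) t ^ 2) (by fun_prop),
      integral_F_pow]
    norm_num
  have e2 : ∀ i, ∫ γ, (∑ j, (1 - F (m + 1) (max (G i γ) (G j γ)))) ∂uniformSphere (m + 1) =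
      ∑ j, psi cvmCdf (m + 1) (angle (X i) (X j)) := by
    intro i
    rw [integral_finsetSum _ fun j _ => hj1 i j]
    refine Finset.sum_congr rfl fun j _ => ?_
    exact (psi_eq m (norm_coe_sphere _) (norm_coe_sphere _) (cos_angle _ _)).symm
  simp_rw [e1, e2]
  simp only [Finset.sum_const, Finset.card_univ, Fintype.card_fin, nsmul_eq_mul, integral_const,
    probReal_univ, smul_eq_mul, one_mul]
  field_simp
  ring

lemma sum_sum_eq_of_symm {n : ℕ} (a : Fin n → Fin n → ℝ) (ha : ∀ i j, a i j = a j i) :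
    ∑ i, ∑ j, a i j = ∑ i, a i i + 2 * ∑ i, ∑ j ∈ Finset.Ioi i, a i j := by
  have h1 : ∀ i, ∑ j, a i j =
      ∑ j ∈ Finset.Iio i, a i j + (a i i + ∑ j ∈ Finset.Ioi i, a i j) := by
    intro i
    rw [← Finset.sum_erase_add _ _ (Finset.mem_univ i)]
    have : Finset.univ.erase i = Finset.Iio i ∪ Finset.Ioi i := by
      ext j
      simp [lt_or_lt_iff_ne]
    rw [this, Finset.sum_union]
    · ring
    · exact Finset.disjoint_left.2 fun j hj hj' =>
        absurd (Finset.mem_Iio.1 hj) (not_lt.2 (Finset.mem_Ioi.1 hj').le)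
  have h2 : ∑ i, ∑ j ∈ Finset.Iio i, a i j = ∑ i, ∑ j ∈ Finset.Ioi i, a i j := by
    rw [Finset.sum_comm' (t' := Finset.univ) (s' := fun j => Finset.Ioi j) (by simp)]
    exact Finset.sum_congr rfl fun i _ => Finset.sum_congr rfl fun j _ => ha j i
  simp_rw [h1]
  rw [Finset.sum_add_distrib, Finset.sum_add_distrib, h2]
  ring

lemma P_eq_sum_pairs (m : ℕ) {n : ℕ} (hn : 1 ≤ n) (X : Fin n → Sphere (m + 1)) :
    P cvmCdf (m + 1) X =
      2 / (n : ℝ) * (∑ i, ∑ j ∈ Finset.Ioi i, psi cvmCdf (m + 1) (angle (X i) (X j)))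
        + (3 - 2 * (n : ℝ)) / 6 := by
  have hn0 : (n : ℝ) ≠ 0 := by positivity
  rw [P_eq_double_sum m hn X, sum_sum_eq_of_symm _ fun i j => by rw [angle_comm]]
  simp_rw [angle_self, psi_zero]
  simp only [Finset.sum_const, Finset.card_univ, Fintype.card_fin, nsmul_eq_mul]
  field_simp
  ring

/-! ### Reduction of the kernel to one-dimensional integrals -/

/-- Folding an integral against the symmetric law `projLaw` onto the positive half line. -/
lemma integral_projLaw_eq_setIntegral_Ioi (m : ℕ) {g : ℝ → ℝ}
    (hi : Integrable g (projLaw (m + 1))) :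
    ∫ t, g t ∂projLaw (m + 1) = ∫ t in Set.Ioi 0, (g t + g (-t)) ∂projLaw (m + 1) := by
  have hmp : MeasurePreserving (fun t : ℝ => -t) (projLaw (m + 1)) (projLaw (m + 1)) :=
    ⟨by fun_prop, projLaw_map_neg _⟩
  have hneg : ∫ t in Set.Iic 0, g t ∂projLaw (m + 1) =
      ∫ t in Set.Ioi 0, g (-t) ∂projLaw (m + 1) := by
    have h := hmp.setIntegral_preimage_emb (MeasurableEquiv.neg ℝ).measurableEmbedding g
      (Set.Iic 0)
    rw [← h, restrict_Ioi_eq_restrict_Ici]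
    congr 2
    ext x
    simp
  have hi' : Integrable (fun t => g (-t)) (projLaw (m + 1)) := hmp.integrable_comp_of_integrable hi
  rw [integral_add hi.integrableOn hi'.integrableOn, ← hneg, add_comm, ← Set.compl_Ioi, add_comm]
  exact (integral_add_compl measurableSet_Ioi hi).symm

lemma integrable_F_pow (q k : ℕ) (μ : Measure ℝ) [IsFiniteMeasure μ] :
    Integrable (fun t => F q t ^ k) μ :=
  integrable_of_bounded ((measurable_F q).pow_const k) 1 fun x =>
    abs_le_one_of_mem (pow_nonneg (F_nonneg q x) k) (pow_le_one₀ (F_nonneg q x) (F_le_one q x))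

lemma integrable_F (q : ℕ) (μ : Measure ℝ) [IsFiniteMeasure μ] : Integrable (F q) μ := by
  simpa using integrable_F_pow q 1 μ

lemma real_Ioi_zero (m : ℕ) : (projLaw (m + 1)).real (Set.Ioi 0) = 1 / 2 := by
  have h := setIntegral_Ioi_F_pow m 0 (x := 0) (by simp)
  simp only [pow_zero, setIntegral_const, smul_eq_mul, mul_one, zero_add, pow_one, F_zero] at h
  rw [h]; norm_num

lemma setIntegral_Ioi_F (m : ℕ) {x : ℝ} (hx : x ∈ Set.Icc (-1 : ℝ) 1) :
    ∫ t in Set.Ioi x, F (m + 1) t ∂projLaw (m + 1) = (1 - F (m + 1) x ^ 2) / 2 := by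
  have h := setIntegral_Ioi_F_pow m 1 hx
  simp only [pow_one] at h
  rw [h]; norm_num

/-- The kernel at antipodal points. -/
lemma psi_pi (m : ℕ) : psi cvmCdf (m + 1) Real.pi = 1 / 4 := by
  have hd := norm_dir m 0
  -- Taking v = -u makes the maximum of the projections |γ'u|, a function of one projection only.
  rw [psi_eq m hd (v := -dir (m + 1) 0) (by rw [norm_neg, hd])
    (by rw [inner_neg_right, inner_dir_dir, sub_self, Real.cos_zero, Real.cos_pi])]
  simp only [inner_neg_right]
  have hm : Measurable fun t : ℝ => 1 - F (m + 1) (max t (-t)) := by fun_prop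
  rw [integral_inner m hd hm, integral_projLaw_eq_setIntegral_Ioi m
    (integrable_of_bounded hm 1 fun t => abs_le_one_of_mem (by linarith [F_le_one (m + 1) (max t (-t))])
      (by linarith [F_nonneg (m + 1) (max t (-t))]))]
  have : ∀ t ∈ Set.Ioi (0 : ℝ), (1 - F (m + 1) (max t (-t))) + (1 - F (m + 1) (max (-t) (- -t))) =
      2 - 2 * F (m + 1) t := by
    intro t ht
    have ht : 0 < t := ht
    rw [neg_neg, max_comm (-t), max_eq_left (by linarith : -t ≤ t)]
    ring
  rw [setIntegral_congr_fun measurableSet_Ioi this, integral_sub (integrable_const _)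
    ((integrable_F _ _).const_mul 2), integral_const_mul, setIntegral_Ioi_F m (by simp), F_zero,
    setIntegral_const, real_Ioi_zero]
  norm_num

lemma measurable_ite_lt {α : Type*} [MeasurableSpace α] {f g : α → ℝ} (hf : Measurable f)
    (hg : Measurable g) : Measurable fun x => if f x < g x then (1 : ℝ) else 0 :=
  Measurable.ite (measurableSet_lt hf hg) measurable_const measurable_const

lemma ite_nonneg_le_one (p : Prop) [Decidable p] :
    0 ≤ (if p then (1 : ℝ) else 0) ∧ (if p then (1 : ℝ) else 0) ≤ 1 := by
  split_ifs <;> norm_num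

/-- The kernel as an integral over the half space where the first projection dominates. -/
lemma psi_eq_sub_two_mul (m : ℕ) {θ : ℝ} (h0 : 0 < θ) (hπ : θ < Real.pi) :
    psi cvmCdf (m + 1) θ = 1 - 2 * ∫ γ : Sphere (m + 1),
      F (m + 1) ((γ : EuclideanSpace ℝ (Fin (m + 2))) 0) *
        (if (γ : EuclideanSpace ℝ (Fin (m + 2))) 1 <
          Real.tan (θ / 2) * (γ : EuclideanSpace ℝ (Fin (m + 2))) 0 then (1 : ℝ) else 0)
      ∂uniformSphere (m + 1) := by
  have hu := norm_dir m 0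
  have hv := norm_dir m θ
  have huv : ⟪dir (m + 1) 0, dir (m + 1) θ⟫ = Real.cos θ := by rw [inner_dir_dir, sub_zero]
  have hs : 0 < Real.sin (θ / 2) := Real.sin_pos_of_pos_of_lt_pi (by linarith) (by linarith)
  have hc : 0 < Real.cos (θ / 2) := Real.cos_pos_of_mem_Ioo ⟨by linarith, by linarith⟩
  have hsin : Real.sin θ = 2 * Real.sin (θ / 2) * Real.cos (θ / 2) := by
    rw [← Real.sin_two_mul]; ring_nf
  have hcos : Real.cos θ = 1 - 2 * Real.sin (θ / 2) ^ 2 := by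
    have := Real.cos_two_mul (θ / 2)
    rw [Real.cos_sq', mul_div_cancel₀ θ two_ne_zero] at this
    linarith
  set a : Sphere (m + 1) → ℝ := fun γ =>
    ⟪(γ : EuclideanSpace ℝ (Fin (m + 2))), dir (m + 1) 0⟫ with ha
  set b : Sphere (m + 1) → ℝ := fun γ =>
    ⟪(γ : EuclideanSpace ℝ (Fin (m + 2))), dir (m + 1) θ⟫ with hb
  have ham : Measurable a := by simp only [ha]; fun_prop
  have hbm : Measurable b := by simp only [hb]; fun_prop
  have hFm := measurable_F (m + 1)
  -- Half-angle factorization: a - b = 2 sin(θ/2) (sin(θ/2) γ₀ - cos(θ/2) γ₁), and dividing by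
  -- cos(θ/2) > 0 produces the tangent.
  have key : ∀ γ : Sphere (m + 1), b γ < a γ ↔ (γ : EuclideanSpace ℝ (Fin (m + 2))) 1 <
      Real.tan (θ / 2) * (γ : EuclideanSpace ℝ (Fin (m + 2))) 0 := by
    intro γ
    have hdiff : a γ - b γ = 2 * Real.sin (θ / 2) *
        (Real.sin (θ / 2) * (γ : EuclideanSpace ℝ (Fin (m + 2))) 0 -
          (γ : EuclideanSpace ℝ (Fin (m + 2))) 1 * Real.cos (θ / 2)) := by
      simp only [ha, hb, inner_dir, Real.cos_zero, Real.sin_zero, hsin, hcos]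
      ring
    rw [← sub_pos, hdiff, mul_pos_iff_of_pos_left (mul_pos two_pos hs), sub_pos,
      Real.tan_eq_sin_div_cos, div_mul_eq_mul_div, lt_div_iff₀ hc]
  -- A tie means that the projection on the nonzero vector w = u - v vanishes, an event of
  -- probability zero since the projected law has no atoms.
  have hne : ∀ᵐ γ ∂uniformSphere (m + 1), a γ ≠ b γ := by
    set w := dir (m + 1) 0 - dir (m + 1) θ with hw
    have hwn : w ≠ 0 := by
      intro h
      have : ⟪dir (m + 1) 0, dir (m + 1) 0 - dir (m + 1) θ⟫ = 0 := by rw [← hw, h, inner_zero_right]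
      rw [inner_sub_right, inner_dir_dir, huv, sub_self, Real.cos_zero, hcos] at this
      nlinarith
    have hw1 : ‖‖w‖⁻¹ • w‖ = 1 := norm_smul_inv_norm (𝕜 := ℝ) hwn
    have h1 : ∀ᵐ t ∂projLaw (m + 1), t ≠ 0 := by
      rw [ae_iff]; simp
    rw [← map_inner m hw1] at h1
    filter_upwards [ae_of_ae_map (by fun_prop) h1] with γ hγ hab
    apply hγ
    rw [inner_smul_right, hw, inner_sub_right]
    simp only [ha, hb] at hab
    rw [hab, sub_self, mul_zero]
  -- The pairs (u, v) and (v, u) have the same inner product, so their projections have the same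
  -- joint law; this is the origin of the factor 2.
  have hswap : ∫ γ, F (m + 1) (b γ) * (if a γ < b γ then (1 : ℝ) else 0) ∂uniformSphere (m + 1) =
      ∫ γ, F (m + 1) (a γ) * (if b γ < a γ then (1 : ℝ) else 0) ∂uniformSphere (m + 1) :=
    integral_inner_pair_congr m hv hu hu hv (real_inner_comm _ _)
      (g := fun p => F (m + 1) p.1 * (if p.2 < p.1 then (1 : ℝ) else 0))
      ((by fun_prop : Measurable fun p : ℝ × ℝ => F (m + 1) p.1).mul
        (measurable_ite_lt measurable_snd measurable_fst))
  have hI : ∀ {f g h : Sphere (m + 1) → ℝ}, Measurable f → Measurable g → Measurable h →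
      Integrable (fun γ => F (m + 1) (f γ) * (if g γ < h γ then (1 : ℝ) else 0))
        (uniformSphere (m + 1)) := fun hf hg hh =>
    integrable_of_bounded ((hFm.comp hf).mul (measurable_ite_lt hg hh)) 1 fun γ =>
      abs_le_one_of_mem (mul_nonneg (F_nonneg _ _) (ite_nonneg_le_one _).1)
        (mul_le_one₀ (F_le_one _ _) (ite_nonneg_le_one _).1 (ite_nonneg_le_one _).2)
  have hmax : ∀ᵐ γ ∂uniformSphere (m + 1), 1 - F (m + 1) (max (a γ) (b γ)) =
      1 - (F (m + 1) (a γ) * (if b γ < a γ then (1 : ℝ) else 0) +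
        F (m + 1) (b γ) * (if a γ < b γ then (1 : ℝ) else 0)) := by
    filter_upwards [hne] with γ hγ
    rcases lt_or_gt_of_ne hγ with h | h
    · rw [if_pos h, if_neg h.not_gt, max_eq_right h.le]; ring
    · rw [if_pos h, if_neg h.not_gt, max_eq_left h.le]; ring
  rw [psi_eq m hu hv huv, integral_congr_ae hmax,
    integral_sub (f := fun _ => (1 : ℝ))
      (g := fun γ => F (m + 1) (a γ) * (if b γ < a γ then (1 : ℝ) else 0) +
        F (m + 1) (b γ) * (if a γ < b γ then (1 : ℝ) else 0))
      (integrable_const _) ((hI ham hbm ham).add (hI hbm ham hbm)),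
    integral_add (hI ham hbm ham) (hI hbm ham hbm), hswap, ← two_mul]
  simp only [integral_const, probReal_univ, smul_eq_mul, mul_one]
  congr 2
  refine integral_congr_ae (Filter.Eventually.of_forall fun γ => ?_)
  have h0 : a γ = (γ : EuclideanSpace ℝ (Fin (m + 2))) 0 := by simp [ha, inner_dir]
  simp only [key]
  rw [h0]

/-- Conditioning on the first coordinate, for `q ≥ 2`. -/
lemma integral_mul_ite_coord_lt (k : ℕ) {w : ℝ → ℝ} (hw : Measurable w)
    (hw1 : ∀ x, |w x| ≤ 1) (τ : ℝ) :
    ∫ γ : Sphere (k + 2), w ((γ : EuclideanSpace ℝ (Fin (k + 3))) 0) *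
        (if (γ : EuclideanSpace ℝ (Fin (k + 3))) 1 <
          τ * (γ : EuclideanSpace ℝ (Fin (k + 3))) 0 then (1 : ℝ) else 0)
      ∂uniformSphere (k + 2) =
    ∫ t, w t * F (k + 1) (t * τ / Real.sqrt (1 - t ^ 2)) ∂projLaw (k + 2) := by
  have hgm : Measurable fun p : ℝ × ℝ => w p.1 * (if p.2 < τ * p.1 then (1 : ℝ) else 0) :=
    (by fun_prop : Measurable fun p : ℝ × ℝ => w p.1).mul
      (measurable_ite_lt (by fun_prop) (by fun_prop))
  have hgm2 : Measurable fun p : ℝ × ℝ =>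
      w (Real.cos p.1) * (if Real.sin p.1 * p.2 < τ * Real.cos p.1 then (1 : ℝ) else 0) :=
    (by fun_prop : Measurable fun p : ℝ × ℝ => w (Real.cos p.1)).mul
      (measurable_ite_lt (by fun_prop) (by fun_prop))
  have h1 := congrArg (fun μ : Measure (ℝ × ℝ) =>
    ∫ p, w p.1 * (if p.2 < τ * p.1 then (1 : ℝ) else 0) ∂μ) (map_coord_pair (k + 1))
  beta_reduce at h1
  rw [integral_map (by fun_prop) hgm.aestronglyMeasurable,
    integral_map (by fun_prop) hgm.aestronglyMeasurable] at h1
  rw [h1, integral_prod _ (integrable_of_bounded hgm2 1 fun p => ?_),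
    integral_projLaw (k + 1) (by fun_prop)]
  · refine integral_congr_ae ?_
    filter_upwards [ae_angleLaw_mem (k + 1)] with α hα
    have hs := Real.sin_pos_of_pos_of_lt_pi hα.1 hα.2
    have hsq : Real.sqrt (1 - Real.cos α ^ 2) = Real.sin α := by
      rw [← Real.sin_sq, Real.sqrt_sq hs.le]
    rw [integral_const_mul, hsq]
    congr 1
    -- With t = cos α and √(1 - t²) = sin α, the event bounds a single coordinate y of the
    -- equatorial direction.
    have : ∀ y, (if Real.sin α * y < τ * Real.cos α then (1 : ℝ) else 0) =
        Set.indicator (Set.Iio (Real.cos α * τ / Real.sin α)) 1 y := by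
      intro y
      simp only [Set.indicator, Set.mem_Iio, lt_div_iff₀ hs, Pi.one_apply]
      rw [mul_comm y, mul_comm τ]
    simp_rw [this]
    rw [integral_indicator_one measurableSet_Iio, F_eq]
    -- The strict inequality may be weakened because `projLaw (k + 1)` has no atoms; the two points
    -- of Ω_0 would break this on the circle.
    exact measureReal_congr Iio_ae_eq_Iic
  · rw [abs_mul]
    exact mul_le_one₀ (hw1 _) (abs_nonneg _)
      (abs_le_one_of_mem (ite_nonneg_le_one _).1 (ite_nonneg_le_one _).2)

/-- Multiplying by cos(θ/2) > 0 leaves the sine of a difference, so the half plane becomes the half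
circle (θ/2 - π, θ/2). -/
lemma sin_lt_tan_mul_cos_iff {θ φ : ℝ} (h0 : 0 < θ) (hπ : θ < Real.pi) :
    Real.sin φ < Real.tan (θ / 2) * Real.cos φ ↔ Real.sin (φ - θ / 2) < 0 := by
  have hc : 0 < Real.cos (θ / 2) := Real.cos_pos_of_mem_Ioo ⟨by linarith, by linarith⟩
  rw [Real.tan_eq_sin_div_cos, div_mul_eq_mul_div, lt_div_iff₀ hc, Real.sin_sub, sub_neg]
  rw [mul_comm (Real.sin (θ / 2))]

/-- The probability of a planar sector. -/
lemma integral_sector (m : ℕ) {θ : ℝ} (h0 : 0 < θ) (hπ : θ < Real.pi) :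
    ∫ γ : Sphere (m + 1), Set.indicator (Set.Ioi 0) 1 ((γ : EuclideanSpace ℝ (Fin (m + 2))) 0) *
        (if (γ : EuclideanSpace ℝ (Fin (m + 2))) 1 <
          Real.tan (θ / 2) * (γ : EuclideanSpace ℝ (Fin (m + 2))) 0 then (1 : ℝ) else 0)
      ∂uniformSphere (m + 1) = 1 / 4 + θ / (4 * Real.pi) := by
  set S : Set (ℝ × ℝ) := {p | 0 < p.1} ∩ {p | p.2 < Real.tan (θ / 2) * p.1} with hS
  have hSm : MeasurableSet S :=
    (measurableSet_lt measurable_const measurable_fst).inter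
      (measurableSet_lt measurable_snd (by fun_prop))
  -- S is a cone, so in every dimension its probability is its angular width over 2π; the arc is
  -- (-π/2, θ/2).
  have h := lintegral_uniformSphere_homogeneous m (f := S.indicator 1)
    (measurable_one.indicator hSm) (Or.inr fun r hr x y => by
      have : (r * x, r * y) ∈ S ↔ (x, y) ∈ S := by
        simp only [hS, Set.mem_inter_iff, Set.mem_ofPred_eq, mul_pos_iff_of_pos_left hr]
        rw [mul_left_comm, mul_lt_mul_iff_right₀ hr]
      simp only [Set.indicator, this, Pi.one_apply])
  have hL : ∫ γ : Sphere (m + 1),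
        Set.indicator (Set.Ioi 0) 1 ((γ : EuclideanSpace ℝ (Fin (m + 2))) 0) *
          (if (γ : EuclideanSpace ℝ (Fin (m + 2))) 1 <
            Real.tan (θ / 2) * (γ : EuclideanSpace ℝ (Fin (m + 2))) 0 then (1 : ℝ) else 0)
        ∂uniformSphere (m + 1) =
      (∫⁻ γ : Sphere (m + 1), S.indicator 1 ((γ : EuclideanSpace ℝ (Fin (m + 2))) 0,
        (γ : EuclideanSpace ℝ (Fin (m + 2))) 1) ∂uniformSphere (m + 1)).toReal := by
    rw [← integral_toReal]
    · refine integral_congr_ae (Filter.Eventually.of_forall fun γ => ?_)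
      simp only [Set.indicator, hS, Set.mem_inter_iff, Set.mem_ofPred_eq, Set.mem_Ioi, Pi.one_apply]
      by_cases h1 : 0 < (γ : EuclideanSpace ℝ (Fin (m + 2))) 0 <;>
      by_cases h2 : (γ : EuclideanSpace ℝ (Fin (m + 2))) 1 <
        Real.tan (θ / 2) * (γ : EuclideanSpace ℝ (Fin (m + 2))) 0 <;> simp [h1, h2]
    · exact ((measurable_one.indicator hSm).comp (by fun_prop)).aemeasurable
    · refine Filter.Eventually.of_forall fun γ => ?_
      exact (Set.indicator_le_self S 1 _).trans_lt (by simp)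
  have hR : ∫⁻ φ in Set.Ioo (-Real.pi) Real.pi, S.indicator 1 (Real.cos φ, Real.sin φ) =
      ENNReal.ofReal (Real.pi / 2 + θ / 2) := by
    have : ∀ φ ∈ Set.Ioo (-Real.pi) Real.pi, S.indicator (1 : ℝ × ℝ → ENNReal)
        (Real.cos φ, Real.sin φ) = (Set.Ioo (-(Real.pi / 2)) (θ / 2)).indicator 1 φ := by
      intro φ hφ
      have : (Real.cos φ, Real.sin φ) ∈ S ↔ φ ∈ Set.Ioo (-(Real.pi / 2)) (θ / 2) := by
        simp only [hS, Set.mem_inter_iff, Set.mem_ofPred_eq, sin_lt_tan_mul_cos_iff h0 hπ]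
        constructor
        · rintro ⟨h1, h2⟩
          have h3 : -(Real.pi / 2) < φ := by
            by_contra h4
            have := Real.cos_nonpos_of_pi_div_two_le_of_le (x := -φ) (by linarith)
              (by linarith [hφ.1, Real.pi_pos])
            rw [Real.cos_neg] at this
            linarith
          refine ⟨h3, ?_⟩
          by_contra h4
          have := Real.sin_nonneg_of_nonneg_of_le_pi (x := φ - θ / 2) (by linarith)
            (by linarith [hφ.2])
          linarith
        · rintro ⟨h1, h2⟩
          exact ⟨Real.cos_pos_of_mem_Ioo ⟨h1, by linarith⟩,
            Real.sin_neg_of_neg_of_neg_pi_lt (by linarith) (by linarith)⟩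
      simp only [Set.indicator, this, Pi.one_apply]
    rw [setLIntegral_congr_fun measurableSet_Ioo this, lintegral_indicator_one measurableSet_Ioo,
      Measure.restrict_apply measurableSet_Ioo, Set.inter_eq_left.2
        (Set.Ioo_subset_Ioo (by linarith) (by linarith)), Real.volume_Ioo]
    congr 1
    ring
  have hpi := Real.pi_pos
  rw [hL, h, hR, ENNReal.toReal_mul, ENNReal.toReal_inv, ENNReal.toReal_ofReal (by positivity),
    ENNReal.toReal_ofReal (by positivity)]
  field_simp
  ring

/-- The kernel for `q ≥ 2` as a one-dimensional integral, interior angles. -/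
lemma psi_formula_of_mem_Ioo (k : ℕ) {θ : ℝ} (h0 : 0 < θ) (hπ : θ < Real.pi) :
    psi cvmCdf (k + 2) θ =
      -(3 / 4) + θ / (2 * Real.pi) + 2 * F (k + 2) (Real.cos (θ / 2)) ^ 2 -
        4 * ∫ t in Set.Ioc 0 (Real.cos (θ / 2)),
          F (k + 2) t * F (k + 1) (t * Real.tan (θ / 2) / Real.sqrt (1 - t ^ 2))
          ∂projLaw (k + 2) := by
  set c := Real.cos (θ / 2) with hcdef
  set τ := Real.tan (θ / 2) with hτ
  have hs : 0 < Real.sin (θ / 2) := Real.sin_pos_of_pos_of_lt_pi (by linarith) (by linarith)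
  have hc : 0 < c := Real.cos_pos_of_mem_Ioo ⟨by linarith, by linarith⟩
  have hc1 : c ≤ 1 := Real.cos_le_one _
  set μ := projLaw (k + 2) with hμ
  set H : ℝ → ℝ := fun t => F (k + 1) (t * τ / Real.sqrt (1 - t ^ 2)) with hH
  have hHm : Measurable H := by simp only [hH]; fun_prop
  have hH0 : ∀ t, 0 ≤ H t := fun t => F_nonneg _ _
  have hH1 : ∀ t, H t ≤ 1 := fun t => F_le_one _ _
  have hF0 := F_nonneg (k + 2)
  have hF1 := F_le_one (k + 2)
  have hHneg : ∀ t, H (-t) = 1 - H t := by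
    intro t
    simp only [hH]
    rw [← F_neg, neg_sq, neg_mul, neg_div]
  have hHi : ∀ (ρ : Measure ℝ) [IsFiniteMeasure ρ], Integrable H ρ := fun ρ _ =>
    integrable_of_bounded hHm 1 fun t => abs_le_one_of_mem (hH0 t) (hH1 t)
  have hFHm : Measurable fun t => F (k + 2) t * H t := by fun_prop
  have hFHi : ∀ (ρ : Measure ℝ) [IsFiniteMeasure ρ], Integrable (fun t => F (k + 2) t * H t) ρ :=
    fun ρ _ => integrable_of_bounded hFHm 1 fun t =>
      abs_le_one_of_mem (mul_nonneg (hF0 t) (hH0 t)) (mul_le_one₀ (hF1 t) (hH0 t) (hH1 t))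
  have e1 : psi cvmCdf (k + 2) θ = 1 - 2 * ∫ t, F (k + 2) t * H t ∂μ := by
    rw [psi_eq_sub_two_mul (k + 1) h0 hπ, integral_mul_ite_coord_lt k (measurable_F _)
      fun x => abs_le_one_of_mem (hF0 x) (hF1 x)]
  have e2 : ∫ t in Set.Ioi 0, H t ∂μ = 1 / 4 + θ / (4 * Real.pi) := by
    have := integral_mul_ite_coord_lt k (w := Set.indicator (Set.Ioi 0) 1)
      (measurable_one.indicator measurableSet_Ioi)
      (fun x => by by_cases h : x ∈ Set.Ioi (0 : ℝ) <;> simp [h, Set.indicator]) τ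
    rw [integral_sector (k + 1) h0 hπ] at this
    rw [this, ← integral_indicator measurableSet_Ioi]
    refine integral_congr_ae (Filter.Eventually.of_forall fun t => ?_)
    by_cases h : t ∈ Set.Ioi (0 : ℝ) <;> simp [h, hH]
  -- Folding uses FH + (1 - F)(1 - H) = 1 - F - H + 2FH on t > 0. There 1/2 is the mass, 3/8 = (1 -
  -- 1/4)/2 the integral of F, and the next term the sector probability `e2`.
  have e3 : ∫ t, F (k + 2) t * H t ∂μ =
      1 / 2 - 3 / 8 - (1 / 4 + θ / (4 * Real.pi)) +
        2 * ∫ t in Set.Ioi 0, F (k + 2) t * H t ∂μ := by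
    rw [integral_projLaw_eq_setIntegral_Ioi (k + 1) (hFHi _)]
    have : ∀ t, F (k + 2) t * H t + F (k + 2) (-t) * H (-t) =
        (1 - F (k + 2) t) - H t + 2 * (F (k + 2) t * H t) := by
      intro t
      rw [hHneg, F_neg (k + 1)]
      ring
    simp_rw [this]
    rw [integral_add (f := fun t => (1 - F (k + 2) t) - H t)
        (((integrable_const _).sub (integrable_F _ _)).sub (hHi _)) ((hFHi _).const_mul 2),
      integral_sub (f := fun t => 1 - F (k + 2) t) ((integrable_const _).sub (integrable_F _ _))
        (hHi _),
      integral_sub (integrable_const _) (integrable_F _ _), integral_const_mul, e2,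
      setIntegral_Ioi_F (k + 1) (by simp), F_zero, setIntegral_const, real_Ioi_zero]
    norm_num
    rfl
  have e4 : ∫ t in Set.Ioi 0, F (k + 2) t * H t ∂μ =
      ∫ t in Set.Ioc 0 c, F (k + 2) t * H t ∂μ + (1 - F (k + 2) c ^ 2) / 2 := by
    have hdisj : Disjoint (Set.Ioc 0 c) (Set.Ioi c) :=
      Set.disjoint_left.2 fun x hx hx' => absurd hx.2 (not_le.2 hx')
    rw [← Set.Ioc_union_Ioi_eq_Ioi hc.le, setIntegral_union hdisj measurableSet_Ioi
      (hFHi μ).integrableOn (hFHi μ).integrableOn, ← setIntegral_Ioi_F (k + 1) (by constructor <;> linarith)]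
    congr 1
    refine setIntegral_congr_ae measurableSet_Ioi ?_
    filter_upwards [ae_projLaw_mem (k + 1)] with t ht htc
    have htc : c < t := htc
    have hpos : 0 < 1 - t ^ 2 := by nlinarith [ht.1, ht.2]
    -- For t = cos α > cos(θ/2) the argument is cot α · tan(θ/2) with α < θ/2, so it exceeds 1 and H
    -- = 1.
    have harg : 1 ≤ t * τ / Real.sqrt (1 - t ^ 2) := by
      rw [one_le_div (Real.sqrt_pos.2 hpos), Real.sqrt_le_left (by
        have : 0 < τ := by rw [hτ, Real.tan_eq_sin_div_cos]; positivity
        nlinarith), hτ, Real.tan_eq_sin_div_cos, ← hcdef, mul_pow, div_pow, mul_div_assoc',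
        le_div_iff₀ (by positivity), Real.sin_sq, ← hcdef]
      nlinarith
    have : H t = 1 := le_antisymm (hH1 t) (by
      rw [← F_one k]
      exact (F (k + 1)).mono harg)
    rw [this, mul_one]
  rw [e1, e3, e4]
  field_simp
  ring

/-- The kernel for `q ≥ 2` as a one-dimensional integral. -/
lemma psi_formula (k : ℕ) {θ : ℝ} (hθ : θ ∈ Set.Icc 0 Real.pi) :
    psi cvmCdf (k + 2) θ =
      -(3 / 4) + θ / (2 * Real.pi) + 2 * F (k + 2) (Real.cos (θ / 2)) ^ 2 -
        4 * ∫ t in Set.Ioc 0 (Real.cos (θ / 2)),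
          F (k + 2) t * F (k + 1) (t * Real.tan (θ / 2) / Real.sqrt (1 - t ^ 2))
          ∂projLaw (k + 2) := by
  rcases hθ.1.eq_or_lt with h0 | h0
  · subst h0
    -- At θ = 0 the argument of F_{q-1} vanishes and the factor is F_{q-1}(0) = 1/2.
    simp only [zero_div, Real.cos_zero, Real.tan_zero, mul_zero, F_zero, F_one (k + 1)]
    have : ∫ t in Set.Ioc 0 1, F (k + 2) t * (1 / 2) ∂projLaw (k + 2) =
        (∫ t in Set.Ioi 0, F (k + 2) t ∂projLaw (k + 2)) * (1 / 2) := by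
      rw [integral_mul_const]
      congr 1
      refine setIntegral_congr_set ?_
      filter_upwards [ae_projLaw_mem (k + 1)] with t ht
      exact propext ⟨fun h => h.1, fun h => ⟨h, ht.2.le⟩⟩
    rw [this, setIntegral_Ioi_F (k + 1) (by simp), F_zero, psi_zero (k + 1)]
    norm_num
  rcases hθ.2.eq_or_lt with hπ | hπ
  · subst hπ
    -- At θ = π the value of the tangent at π/2 does not matter: the interval is empty.
    rw [Real.cos_pi_div_two, Set.Ioc_self, Measure.restrict_empty, integral_zero_measure,
      psi_pi (k + 1), F_zero (k + 1)]
    have := Real.pi_ne_zero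
    field_simp
    norm_num
  · exact psi_formula_of_mem_Ioo k h0 hπ

/-! ### Closed forms of the kernel in low dimension -/

lemma integral_circle {g : ℝ × ℝ → ℝ} (hg : Measurable g) :
    ∫ γ : Sphere 1, g ((γ : EuclideanSpace ℝ (Fin 2)) 0, (γ : EuclideanSpace ℝ (Fin 2)) 1)
        ∂uniformSphere 1 =
      (2 * Real.pi)⁻¹ * ∫ φ in Set.Ioo (-Real.pi) Real.pi, g (Real.cos φ, Real.sin φ) := by
  have h : (uniformSphere 1).map (fun γ : Sphere 1 =>
        ((γ : EuclideanSpace ℝ (Fin 2)) 0, (γ : EuclideanSpace ℝ (Fin 2)) 1)) =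
      (ENNReal.ofReal (2 * Real.pi))⁻¹ • (volume.restrict (Set.Ioo (-Real.pi) Real.pi)).map
        (fun φ => (Real.cos φ, Real.sin φ)) := by
    refine Measure.ext_of_lintegral _ fun f hf => ?_
    rw [lintegral_map hf (by fun_prop), lintegral_smul_measure, lintegral_map hf (by fun_prop),
      smul_eq_mul]
    exact lintegral_uniformSphere_homogeneous 0 hf (Or.inl rfl)
  have h1 := congrArg (fun μ : Measure (ℝ × ℝ) => ∫ p, g p ∂μ) h
  beta_reduce at h1
  rwa [integral_map (by fun_prop) hg.aestronglyMeasurable, integral_smul_measure,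
    integral_map (by fun_prop) hg.aestronglyMeasurable, ENNReal.toReal_inv,
    ENNReal.toReal_ofReal (by positivity), smul_eq_mul] at h1

lemma polarCdf_zero_left (α : ℝ) : polarCdf 0 α = 1 - α / Real.pi := by
  have := Real.pi_ne_zero
  simp only [polarCdf, sinInt, pow_zero, intervalIntegral.integral_const, smul_eq_mul, mul_one,
    sub_zero]
  field_simp

lemma polarCdf_one_left (α : ℝ) : polarCdf 1 α = (1 + Real.cos α) / 2 := by
  simp only [polarCdf, sinInt, pow_one, integral_sin, Real.cos_pi, Real.cos_zero]
  ring

lemma sinInt_two : sinInt 2 = Real.pi / 2 := by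
  rw [sinInt, integral_sin_sq]; simp

lemma polarCdf_two_left (α : ℝ) :
    polarCdf 2 α = 1 - α / Real.pi + Real.sin α * Real.cos α / Real.pi := by
  have := Real.pi_ne_zero
  rw [polarCdf, sinInt_two, integral_sin_sq]
  simp only [Real.sin_pi, zero_mul, sub_zero]
  field_simp
  ring

/-- The kernel on the circle. -/
lemma psi_one {θ : ℝ} (hθ : θ ∈ Set.Icc 0 Real.pi) :
    psi cvmCdf 1 θ = 1 / 2 + θ / (2 * Real.pi) * (θ / (2 * Real.pi) - 1) := by
  have hpi := Real.pi_pos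
  rcases hθ.1.eq_or_lt with h0 | h0
  · subst h0
    rw [psi_zero 0]
    simp
  rcases hθ.2.eq_or_lt with hπ | hπ
  · subst hπ
    rw [psi_pi 0]
    field_simp
    norm_num
  rw [psi_eq_sub_two_mul 0 h0 hπ, integral_circle (g := fun p => F 1 p.1 *
    (if p.2 < Real.tan (θ / 2) * p.1 then (1 : ℝ) else 0))
    ((by fun_prop : Measurable fun p : ℝ × ℝ => F 1 p.1).mul
      (measurable_ite_lt (by fun_prop) (by fun_prop)))]
  have hcongr : ∀ φ ∈ Set.Ioo (-Real.pi) Real.pi, F 1 (Real.cos φ) *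
      (if Real.sin φ < Real.tan (θ / 2) * Real.cos φ then (1 : ℝ) else 0) =
      (Set.Ioo (θ / 2 - Real.pi) (θ / 2)).indicator (fun φ => 1 - |φ| / Real.pi) φ := by
    intro φ hφ
    have hF : F 1 (Real.cos φ) = 1 - |φ| / Real.pi := by
      rw [← Real.cos_abs, F_cos 0 (abs_nonneg _) (abs_le.2 ⟨hφ.1.le, hφ.2.le⟩),
        polarCdf_zero_left]
    have hmem : Real.sin φ < Real.tan (θ / 2) * Real.cos φ ↔
        φ ∈ Set.Ioo (θ / 2 - Real.pi) (θ / 2) := by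
      rw [sin_lt_tan_mul_cos_iff h0 hπ]
      constructor
      · intro h
        constructor
        · by_contra h1
          -- Below the arc, a shift by 2π brings φ - θ/2 into [0, π].
          have := Real.sin_nonneg_of_nonneg_of_le_pi (x := φ - θ / 2 + 2 * Real.pi)
            (by linarith [hφ.1]) (by linarith)
          rw [Real.sin_add_two_pi] at this
          linarith
        · by_contra h1
          have := Real.sin_nonneg_of_nonneg_of_le_pi (x := φ - θ / 2)
            (by linarith) (by linarith [hφ.2])
          linarith
      · rintro ⟨h1, h2⟩
        exact Real.sin_neg_of_neg_of_neg_pi_lt (by linarith) (by linarith)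
    simp only [Set.indicator, ← hmem, hF]
    split_ifs <;> simp
  rw [setIntegral_congr_fun measurableSet_Ioo hcongr, setIntegral_indicator measurableSet_Ioo,
    Set.inter_eq_right.2 (Set.Ioo_subset_Ioo (by linarith) (by linarith)),
    ← integral_Ioc_eq_integral_Ioo, ← intervalIntegral.integral_of_le (by linarith)]
  have hc : Continuous fun φ : ℝ => 1 - |φ| / Real.pi := by fun_prop
  rw [← intervalIntegral.integral_add_adjacent_intervals (b := 0) (hc.intervalIntegrable _ _)
    (hc.intervalIntegrable _ _)]
  have i1 : ∫ φ in (θ / 2 - Real.pi)..0, (1 - |φ| / Real.pi) =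
      ∫ φ in (θ / 2 - Real.pi)..0, (1 + φ / Real.pi) := by
    refine intervalIntegral.integral_congr fun φ hφ => ?_
    rw [Set.uIcc_of_le (by linarith)] at hφ
    simp only [abs_of_nonpos hφ.2]
    ring
  have i2 : ∫ φ in (0 : ℝ)..(θ / 2), (1 - |φ| / Real.pi) =
      ∫ φ in (0 : ℝ)..(θ / 2), (1 - φ / Real.pi) := by
    refine intervalIntegral.integral_congr fun φ hφ => ?_
    rw [Set.uIcc_of_le (by linarith)] at hφ
    simp only [abs_of_nonneg hφ.1]
  have hcd : Continuous fun φ : ℝ => φ / Real.pi := by fun_prop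
  rw [i1, i2, intervalIntegral.integral_add (by simp) (hcd.intervalIntegrable _ _),
    intervalIntegral.integral_sub (by simp) (hcd.intervalIntegrable _ _),
    intervalIntegral.integral_div, intervalIntegral.integral_div, integral_id, integral_id,
    intervalIntegral.integral_const, intervalIntegral.integral_const]
  simp only [smul_eq_mul]
  field_simp
  ring

/-- Archimedes: the projection of the uniform distribution on the two-sphere is uniform. -/
lemma F_two {t : ℝ} (ht : t ∈ Set.Icc (-1 : ℝ) 1) : F 2 t = (1 + t) / 2 := by
  have h := F_cos 1 (Real.arccos_nonneg t) (Real.arccos_le_pi t)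
  rwa [polarCdf_one_left, Real.cos_arccos ht.1 ht.2] at h

/-- Writes t as an affine function of F_2(t), so that moments of t reduce to `integral_F_pow` and
`setIntegral_Ioi_F`. -/
lemma ae_projLaw_two : ∀ᵐ t ∂projLaw 2, t = 2 * F 2 t - 1 := by
  filter_upwards [ae_projLaw_mem 1] with t ht
  rw [F_two ⟨ht.1.le, ht.2.le⟩]
  ring

lemma integrable_id_projLaw_two : Integrable (fun t => t) (projLaw 2) := by
  refine Integrable.congr (f := fun t => 2 * F 2 t - 1)
    (((integrable_F 2 _).const_mul 2).sub (integrable_const _)) ?_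
  filter_upwards [ae_projLaw_two] with t ht using ht.symm

lemma integral_id_projLaw_two : ∫ t, t ∂projLaw 2 = 0 := by
  rw [integral_congr_ae ae_projLaw_two, integral_sub ((integrable_F 2 _).const_mul 2)
    (integrable_const _), integral_const_mul]
  have := integral_F_pow 1 1
  simp only [pow_one] at this
  rw [this]
  norm_num

lemma integral_abs_projLaw_two : ∫ t, |t| ∂projLaw 2 = 1 / 2 := by
  rw [integral_projLaw_eq_setIntegral_Ioi 1 integrable_id_projLaw_two.abs]
  have h : ∫ t in Set.Ioi 0, (|t| + |-t|) ∂projLaw 2 =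
      ∫ t in Set.Ioi 0, (4 * F 2 t - 2) ∂projLaw 2 := by
    refine setIntegral_congr_ae measurableSet_Ioi ?_
    filter_upwards [ae_projLaw_two] with t ht hpos
    have hpos : 0 < t := hpos
    rw [abs_neg, abs_of_pos hpos]
    linarith
  rw [h, integral_sub ((integrable_F 2 _).const_mul 4) (integrable_const _), integral_const_mul,
    setIntegral_Ioi_F 1 (by simp), F_zero, setIntegral_const, real_Ioi_zero]
  norm_num

/-- The kernel on the two-sphere is affine in the chordal distance. -/
lemma psi_two_eq_norm {u v : EuclideanSpace ℝ (Fin 3)} (hu : ‖u‖ = 1) (hv : ‖v‖ = 1) {θ : ℝ}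
    (huv : ⟪u, v⟫ = Real.cos θ) : psi cvmCdf 2 θ = 1 / 2 - ‖u - v‖ / 8 := by
  rw [psi_eq 1 hu hv huv]
  -- F_2 is affine on [-1, 1], and max(a, b) = (a + b + |a - b|)/2.
  have hpt : ∀ γ : Sphere 2, 1 - F 2 (max ⟪(γ : EuclideanSpace ℝ (Fin 3)), u⟫
      ⟪(γ : EuclideanSpace ℝ (Fin 3)), v⟫) =
      1 / 2 - 1 / 4 * (⟪(γ : EuclideanSpace ℝ (Fin 3)), u⟫ +
        ⟪(γ : EuclideanSpace ℝ (Fin 3)), v⟫) -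
        1 / 4 * |⟪(γ : EuclideanSpace ℝ (Fin 3)), u - v⟫| := by
    intro γ
    have h1 := inner_mem_Icc γ hu
    have h2 := inner_mem_Icc γ hv
    rw [F_two ⟨le_max_of_le_left h1.1, max_le h1.2 h2.2⟩, inner_sub_right]
    rcases le_total ⟪(γ : EuclideanSpace ℝ (Fin 3)), u⟫ ⟪(γ : EuclideanSpace ℝ (Fin 3)), v⟫
      with h | h
    · rw [max_eq_right h, abs_of_nonpos (by linarith)]; ring
    · rw [max_eq_left h, abs_of_nonneg (by linarith)]; ring
  have hbd : ∀ w : EuclideanSpace ℝ (Fin 3), Integrable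
      (fun γ : Sphere 2 => ⟪(γ : EuclideanSpace ℝ (Fin 3)), w⟫) (uniformSphere 2) := fun w =>
    integrable_of_bounded (by fun_prop) ‖w‖ fun γ => by
      have := abs_real_inner_le_norm (γ : EuclideanSpace ℝ (Fin 3)) w
      rwa [norm_coe_sphere, one_mul] at this
  have hmean : ∀ {w : EuclideanSpace ℝ (Fin 3)}, ‖w‖ = 1 →
      ∫ γ : Sphere 2, ⟪(γ : EuclideanSpace ℝ (Fin 3)), w⟫ ∂uniformSphere 2 = 0 := fun hw => by
    rw [integral_inner 1 hw (g := fun t => t) measurable_id, integral_id_projLaw_two]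
  -- Rescaling to a unit vector is needed because it will be used for w = u - v; the case w = 0 is
  -- separate.
  have habs : ∀ w : EuclideanSpace ℝ (Fin 3),
      ∫ γ : Sphere 2, |⟪(γ : EuclideanSpace ℝ (Fin 3)), w⟫| ∂uniformSphere 2 = ‖w‖ / 2 := by
    intro w
    by_cases hw : w = 0
    · simp [hw]
    · have hw1 : ‖‖w‖⁻¹ • w‖ = 1 := norm_smul_inv_norm (𝕜 := ℝ) hw
      have hpt : ∀ γ : Sphere 2, |⟪(γ : EuclideanSpace ℝ (Fin 3)), w⟫| =
          ‖w‖ * |⟪(γ : EuclideanSpace ℝ (Fin 3)), ‖w‖⁻¹ • w⟫| := by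
        intro γ
        have : ‖w‖ ≠ 0 := norm_ne_zero_iff.2 hw
        rw [inner_smul_right, abs_mul, abs_of_nonneg (inv_nonneg.2 (norm_nonneg w)), ← mul_assoc,
          mul_inv_cancel₀ this, one_mul]
      simp_rw [hpt]
      rw [integral_const_mul, integral_inner 1 hw1 (g := fun t => |t|) (by fun_prop),
        integral_abs_projLaw_two]
      ring
  simp_rw [hpt]
  have hsum : Integrable (fun γ : Sphere 2 => ⟪(γ : EuclideanSpace ℝ (Fin 3)), u⟫ +
      ⟪(γ : EuclideanSpace ℝ (Fin 3)), v⟫) (uniformSphere 2) := (hbd u).add (hbd v)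
  rw [integral_sub (f := fun γ : Sphere 2 => 1 / 2 - 1 / 4 *
      (⟪(γ : EuclideanSpace ℝ (Fin 3)), u⟫ + ⟪(γ : EuclideanSpace ℝ (Fin 3)), v⟫))
      ((integrable_const _).sub (hsum.const_mul _)) ((hbd _).abs.const_mul _),
    integral_sub (integrable_const _) (hsum.const_mul _), integral_const_mul, integral_const_mul,
    integral_add (hbd u) (hbd v), hmean hu, hmean hv, habs]
  simp only [integral_const, probReal_univ, smul_eq_mul]
  ring

lemma norm_sub_eq_two_mul_sin {q : ℕ} {u v : EuclideanSpace ℝ (Fin q)} (hu : ‖u‖ = 1)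
    (hv : ‖v‖ = 1) {θ : ℝ} (hθ : θ ∈ Set.Icc 0 Real.pi) (huv : ⟪u, v⟫ = Real.cos θ) :
    ‖u - v‖ = 2 * Real.sin (θ / 2) := by
  have hs := Real.sin_nonneg_of_nonneg_of_le_pi (x := θ / 2) (by linarith [hθ.1])
    (by linarith [hθ.2, hθ.1])
  rw [← sq_eq_sq₀ (norm_nonneg _) (by positivity), norm_sub_sq_real, hu, hv, huv]
  have := Real.cos_two_mul (θ / 2)
  rw [Real.cos_sq', mul_div_cancel₀ θ two_ne_zero] at this
  rw [this]
  ring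

lemma psi_two {θ : ℝ} (hθ : θ ∈ Set.Icc 0 Real.pi) :
    psi cvmCdf 2 θ = 1 / 2 - 1 / 4 * Real.sin (θ / 2) := by
  have huv : ⟪dir 2 0, dir 2 θ⟫ = Real.cos θ := by rw [inner_dir_dir, sub_zero]
  rw [psi_two_eq_norm (norm_dir 1 0) (norm_dir 1 θ) huv,
    norm_sub_eq_two_mul_sin (norm_dir 1 0) (norm_dir 1 θ) hθ huv]
  ring

/-- On 0 < t ≤ cos(θ/2) the argument of F_2 lies in [0, 1], where F_2 is affine. With t = cos α the
integral becomes elementary. -/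
lemma psi_three {θ : ℝ} (hθ : θ ∈ Set.Ico 0 Real.pi) :
    psi cvmCdf 3 θ = psi cvmCdf 1 θ + 1 / (4 * Real.pi ^ 2) *
      ((Real.pi - θ) * Real.tan (θ / 2) - 2 * Real.sin (θ / 2) ^ 2) := by
  have hpi := Real.pi_pos
  rcases hθ.1.eq_or_lt with h0 | h0
  · subst h0
    rw [psi_zero 2, psi_zero 0]
    simp
  have hπ := hθ.2
  obtain ⟨β, rfl⟩ : ∃ β, θ = 2 * β := ⟨θ / 2, by ring⟩
  rw [psi_formula 1 ⟨hθ.1, hθ.2.le⟩, psi_one ⟨hθ.1, hθ.2.le⟩, mul_div_cancel_left₀ β two_ne_zero]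
  have hβ0 : 0 < β := by linarith
  have hβ1 : β < Real.pi / 2 := by linarith
  have hc : 0 < Real.cos β := Real.cos_pos_of_mem_Ioo ⟨by linarith, by linarith⟩
  have hτ : Real.tan β * Real.cos β = Real.sin β := Real.tan_mul_cos hc.ne'
  set τ := Real.tan β
  have hint : ∫ t in Set.Ioc 0 (Real.cos β),
      F 3 t * F 2 (t * τ / Real.sqrt (1 - t ^ 2)) ∂projLaw 3 =
      ∫ α in β..(Real.pi / 2), (sinInt 2)⁻¹ * Real.sin α ^ 2 * polarCdf 2 α / 2 +
        τ / Real.pi * (polarCdf 2 α * (Real.sin α * Real.cos α)) := by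
    have h := setIntegral_projLaw 2
      (g := fun t => F 3 t * F 2 (t * τ / Real.sqrt (1 - t ^ 2))) (by fun_prop) hβ0.le hβ1.le
      (by linarith)
    rw [Real.cos_pi_div_two] at h
    rw [h, ← intervalIntegral.integral_const_mul]
    refine intervalIntegral.integral_congr fun α hα => ?_
    rw [Set.uIcc_of_le hβ1.le] at hα
    have hs : 0 < Real.sin α := Real.sin_pos_of_pos_of_lt_pi (by linarith [hα.1])
      (by linarith [hα.2])
    have hcα : 0 ≤ Real.cos α := Real.cos_nonneg_of_mem_Icc ⟨by linarith [hα.1], hα.2⟩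
    have hsq : Real.sqrt (1 - Real.cos α ^ 2) = Real.sin α := by
      rw [← Real.sin_sq, Real.sqrt_sq hs.le]
    have hτ0 : 0 ≤ τ := by
      have : 0 < Real.sin β := Real.sin_pos_of_pos_of_lt_pi hβ0 (by linarith)
      nlinarith
    have hle : Real.cos α * τ / Real.sin α ≤ 1 := by
      rw [div_le_one hs]
      have h1 : 0 ≤ Real.sin (α - β) :=
        Real.sin_nonneg_of_nonneg_of_le_pi (by linarith [hα.1]) (by linarith [hα.2])
      rw [Real.sin_sub, ← hτ] at h1
      refine le_of_mul_le_mul_right (a := Real.cos β) ?_ hc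
      linarith
    have hge : -1 ≤ Real.cos α * τ / Real.sin α :=
      le_trans (by norm_num) (div_nonneg (mul_nonneg hcα hτ0) hs.le)
    simp only [hsq]
    rw [F_two ⟨hge, hle⟩, F_cos 2 (by linarith [hα.1]) (by linarith [hα.2]), sinInt_two]
    field_simp
  -- The first summand integrates `polarCdf 2` against its own derivative. The next two are
  -- integration by parts of (1 - α/π) sin α cos α. The last integrates sin² α cos² α / π, with 1 -
  -- 2 sin² α standing for cos 2α.
  have hprim : ∀ α : ℝ, HasDerivAt (fun α => -(polarCdf 2 α ^ 2 / 4) + τ / Real.pi *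
      ((1 - α / Real.pi) * (Real.sin α ^ 2 / 2) +
        (α - Real.sin α * Real.cos α) / (4 * Real.pi) +
        (α - Real.sin α * Real.cos α * (1 - 2 * Real.sin α ^ 2)) / (8 * Real.pi)))
      ((sinInt 2)⁻¹ * Real.sin α ^ 2 * polarCdf 2 α / 2 +
        τ / Real.pi * (polarCdf 2 α * (Real.sin α * Real.cos α))) α := by
    intro α
    have hs := Real.hasDerivAt_sin α
    have hcs := Real.hasDerivAt_cos α
    have hid := hasDerivAt_id' α
    have h1 := ((hid.div_const Real.pi).const_sub 1).mul ((hs.pow 2).div_const 2)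
    have h2 := (hid.sub (hs.mul hcs)).div_const (4 * Real.pi)
    have h3 := (hid.sub ((hs.mul hcs).mul (((hs.pow 2).const_mul 2).const_sub 1))).div_const
      (8 * Real.pi)
    have h4 := (((hasDerivAt_polarCdf 2 α).pow 2).div_const 4).neg
    refine (h4.add (((h1.add h2).add h3).const_mul (τ / Real.pi))).congr_deriv ?_
    rw [polarCdf_two_left, sinInt_two, inv_div]
    have hsc := Real.sin_sq_add_cos_sq α
    simp only [Pi.mul_apply, Pi.pow_apply, Nat.add_one_sub_one, pow_one]
    generalize Real.sin α = s at *
    generalize Real.cos α = c at *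
    have hcc : c ^ 2 = 1 - s ^ 2 := by linarith
    field_simp
    ring_nf
    simp only [hcc]
    ring
  have hFc := continuous_polarCdf 2
  have hsc := Real.sin_sq_add_cos_sq β
  rw [hint, intervalIntegral.integral_eq_sub_of_hasDerivAt (fun α _ => hprim α)
    ((by fun_prop : Continuous fun α => (sinInt 2)⁻¹ * Real.sin α ^ 2 * polarCdf 2 α / 2 +
        τ / Real.pi * (polarCdf 2 α * (Real.sin α * Real.cos α))).intervalIntegrable _ _),
    F_cos 2 hβ0.le (by linarith), polarCdf_two_left, polarCdf_two_left, Real.cos_pi_div_two,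
    Real.sin_pi_div_two]
  have e1 : τ * Real.sin β ^ 2 = τ - Real.sin β * Real.cos β := by
    rw [← hτ] at hsc ⊢
    linear_combination τ * hsc
  have e2 : τ * (Real.sin β * Real.cos β) = Real.sin β ^ 2 := by
    linear_combination Real.sin β * hτ
  -- Modulo `e1` and `e2`, which reduce products of τ with sines and cosines, and sin² + cos² = 1,
  -- both sides agree as polynomials.
  linear_combination (norm := (field_simp; ring))
    (2 / Real.pi) * (1 - β / Real.pi) * e1 - (3 / 2) / Real.pi ^ 2 * e2 +
      Real.sin β ^ 2 / Real.pi ^ 2 * e2 + Real.sin β ^ 2 / Real.pi ^ 2 * hsc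

/-! ### Watson's and Bakshaev's statistics -/

lemma arccos_cos_sub {s t : ℝ} (hs : s ∈ Set.Ico 0 (2 * Real.pi))
    (ht : t ∈ Set.Ico 0 (2 * Real.pi)) :
    Real.arccos (Real.cos (s - t)) = |s - t| ∨
      Real.arccos (Real.cos (s - t)) = 2 * Real.pi - |s - t| := by
  have hlt : |s - t| ≤ 2 * Real.pi := abs_le.2 ⟨by linarith [hs.1, ht.2], by linarith [hs.2, ht.1]⟩
  rw [← Real.cos_abs]
  rcases le_total |s - t| Real.pi with h | h
  · exact Or.inl (Real.arccos_cos (abs_nonneg _) h)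
  · right
    rw [← Real.cos_two_pi_sub]
    exact Real.arccos_cos (by linarith) (by linarith)

/-- The quadratic ψ_1 is invariant under θ ↦ 2π - θ, so both cases of `arccos_cos_sub` give the same
value in |Θ₁ - Θ₂|. The absolute value is written through the maximum to match `watson_eq`. -/
lemma psi_one_angle {Θ₁ Θ₂ : ℝ} {u v : Sphere 1} (h1 : Θ₁ ∈ Set.Ico 0 (2 * Real.pi))
    (h2 : Θ₂ ∈ Set.Ico 0 (2 * Real.pi))
    (hu : (u : EuclideanSpace ℝ (Fin 2)) 0 = Real.cos Θ₁ ∧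
      (u : EuclideanSpace ℝ (Fin 2)) 1 = Real.sin Θ₁)
    (hv : (v : EuclideanSpace ℝ (Fin 2)) 0 = Real.cos Θ₂ ∧
      (v : EuclideanSpace ℝ (Fin 2)) 1 = Real.sin Θ₂) :
    psi cvmCdf 1 (angle u v) =
      1 / 2 + (Θ₁ - Θ₂) ^ 2 / (4 * Real.pi ^ 2) - (2 * max Θ₁ Θ₂ - Θ₁ - Θ₂) / (2 * Real.pi) := by
  have hpi := Real.pi_pos
  have hang : angle u v = Real.arccos (Real.cos (Θ₁ - Θ₂)) := by
    rw [angle, PiLp.inner_apply]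
    congr 1
    have := Fin.sum_univ_two fun i : Fin 2 => ⟪(u : EuclideanSpace ℝ (Fin 2)) i,
      (v : EuclideanSpace ℝ (Fin 2)) i⟫
    refine this.trans ?_
    rw [hu.1, hu.2, hv.1, hv.2, Real.cos_sub]
    simp [mul_comm]
  have habs : 2 * max Θ₁ Θ₂ - Θ₁ - Θ₂ = |Θ₁ - Θ₂| := by
    rcases le_total Θ₁ Θ₂ with h | h
    · rw [max_eq_right h, abs_of_nonpos (by linarith)]; ring
    · rw [max_eq_left h, abs_of_nonneg (by linarith)]; ring
  rw [psi_one (angle_mem u v), habs, hang, ← sq_abs]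
  rcases arccos_cos_sub h1 h2 with h | h
  · rw [h]; field_simp; ring
  · rw [h]; field_simp; ring

lemma setIntegral_ite_le_mul_pow (k : ℕ) {a c : ℝ} (ha : a ∈ Set.Icc 0 c) :
    ∫ x in Set.Ioc 0 c, (if a ≤ x then (1 : ℝ) else 0) * x ^ k =
      (c ^ (k + 1) - a ^ (k + 1)) / (k + 1) := by
  have h : ∀ x, (if a ≤ x then (1 : ℝ) else 0) * x ^ k =
      (Set.Ici a).indicator (fun x => x ^ k) x := by
    intro x
    by_cases h : a ≤ x <;> simp [h]
  simp_rw [h]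
  rw [setIntegral_indicator measurableSet_Ici, ← integral_pow,
    intervalIntegral.integral_of_le ha.2]
  refine setIntegral_congr_set ?_
  refine (Filter.EventuallyEq.inter Ioc_ae_eq_Icc Filter.EventuallyEq.rfl).trans ?_
  refine Filter.EventuallyEq.trans ?_ Ioc_ae_eq_Icc.symm
  exact Filter.EventuallyEq.of_eq <| Set.ext fun x =>
    ⟨fun h => ⟨h.2, h.1.2⟩, fun h => ⟨⟨ha.1.trans h.1, h.2⟩, h.1⟩⟩

/-- Watson's statistic in terms of the moments and pairwise maxima of the sample. -/
lemma watson_eq {n : ℕ} (hn : 1 ≤ n) {Θ : Fin n → ℝ} (hΘ : ∀ i, Θ i ∈ Set.Ico 0 (2 * Real.pi)) :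
    watson Θ = -(∑ i, ∑ j, max (Θ i) (Θ j)) / (2 * Real.pi * n) +
      (∑ i, Θ i ^ 2) / (4 * Real.pi ^ 2) + n / 12 + (∑ i, Θ i) / (2 * Real.pi) -
      (∑ i, Θ i) ^ 2 / (4 * Real.pi ^ 2 * n) := by
  have hpi := Real.pi_pos
  have hn0 : (n : ℝ) ≠ 0 := by positivity
  have hmem : ∀ i, Θ i ∈ Set.Icc 0 (2 * Real.pi) := fun i => ⟨(hΘ i).1, (hΘ i).2.le⟩
  have hmax : ∀ i j, max (Θ i) (Θ j) ∈ Set.Icc 0 (2 * Real.pi) := fun i j =>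
    ⟨le_max_of_le_left (hmem i).1, max_le (hmem i).2 (hmem j).2⟩
  have hind : ∀ a : ℝ, Measurable fun x : ℝ => if a ≤ x then (1 : ℝ) else 0 := fun a =>
    Measurable.ite (measurableSet_le (by fun_prop) (by fun_prop)) (by fun_prop) (by fun_prop)
  have hpow : ∀ k : ℕ, IntegrableOn (fun x : ℝ => x ^ k) (Set.Ioc 0 (2 * Real.pi)) := fun k =>
    ((continuous_pow k).intervalIntegrable 0 (2 * Real.pi)).1
  have hi : ∀ (a : ℝ) (k : ℕ), IntegrableOn (fun x => (if a ≤ x then (1 : ℝ) else 0) * x ^ k)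
      (Set.Ioc 0 (2 * Real.pi)) := fun a k =>
    (hpow k).bdd_mul (c := 1) (hind a).aestronglyMeasurable (Filter.Eventually.of_forall fun x => by
      rw [Real.norm_eq_abs]
      exact abs_le_one_of_mem (ite_nonneg_le_one _).1 (ite_nonneg_le_one _).2)
  have hval : ∀ k : ℕ, ∫ x in Set.Ioc 0 (2 * Real.pi), x ^ k =
      (2 * Real.pi) ^ (k + 1) / (k + 1) := fun k => by
    rw [← intervalIntegral.integral_of_le (by positivity), integral_pow,
      zero_pow (Nat.succ_ne_zero k), sub_zero]
  -- The powers 0 and 1 and the added zero fit `setIntegral_ite_le_mul_pow` and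
  -- `integral_mul_sub_mul_add`.
  have hexp : ∀ x, circDiscrepancy Θ x =
      (n : ℝ)⁻¹ * (∑ i, (if Θ i ≤ x then (1 : ℝ) else 0) * x ^ 0) -
        (2 * Real.pi)⁻¹ * x ^ 1 + 0 := by
    intro x
    simp only [circDiscrepancy, pow_zero, mul_one, pow_one, add_zero]
    ring
  have hsqexp : ∀ x, circDiscrepancy Θ x ^ 2 =
      (n : ℝ)⁻¹ ^ 2 * (∑ i, ∑ j, (if max (Θ i) (Θ j) ≤ x then (1 : ℝ) else 0) * x ^ 0) -
        (n : ℝ)⁻¹ * Real.pi⁻¹ * (∑ i, (if Θ i ≤ x then (1 : ℝ) else 0) * x ^ 1) +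
        (2 * Real.pi)⁻¹ ^ 2 * x ^ 2 := by
    intro x
    have h1 : (∑ i, ∑ j, (if max (Θ i) (Θ j) ≤ x then (1 : ℝ) else 0) * x ^ 0) =
        (∑ i, if Θ i ≤ x then (1 : ℝ) else 0) ^ 2 := by
      rw [sq, Finset.sum_mul_sum]
      refine Finset.sum_congr rfl fun i _ => Finset.sum_congr rfl fun j _ => ?_
      simp only [max_le_iff, ite_zero_mul_ite_zero, pow_zero, mul_one]
    rw [h1, ← Finset.sum_mul, circDiscrepancy]
    field_simp
    ring
  have I1 : ∫ x in Set.Ioc 0 (2 * Real.pi), circDiscrepancy Θ x =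
      Real.pi - (n : ℝ)⁻¹ * ∑ i, Θ i := by
    simp_rw [hexp]
    rw [integral_mul_sub_mul_add (integrable_finsetSum _ fun i _ => hi (Θ i) 0) (hpow 1)
      (integrable_const 0), integral_finsetSum _ fun i _ => hi (Θ i) 0, hval 1]
    simp_rw [fun i => setIntegral_ite_le_mul_pow 0 (hmem i)]
    simp only [zero_add, pow_one, CharP.cast_eq_zero, div_one, Finset.sum_sub_distrib,
      Finset.sum_const, Finset.card_univ, Fintype.card_fin, nsmul_eq_mul, integral_zero, add_zero]
    field_simp
    norm_num
    ring
  have I2 : ∫ x in Set.Ioc 0 (2 * Real.pi), circDiscrepancy Θ x ^ 2 =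
      2 * Real.pi - (∑ i, ∑ j, max (Θ i) (Θ j)) / n ^ 2 - 2 * Real.pi +
        (∑ i, Θ i ^ 2) / (2 * Real.pi * n) + 2 * Real.pi / 3 := by
    simp_rw [hsqexp]
    rw [integral_mul_sub_mul_add
      (integrable_finsetSum _ fun i _ => integrable_finsetSum _ fun j _ => hi (max (Θ i) (Θ j)) 0)
      (integrable_finsetSum _ fun i _ => hi (Θ i) 1) ((hpow 2).const_mul _),
      integral_finsetSum _ fun i _ => integrable_finsetSum _ fun j _ => hi (max (Θ i) (Θ j)) 0,
      integral_finsetSum _ fun i _ => hi (Θ i) 1, integral_const_mul, hval 2]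
    simp_rw [fun i => integral_finsetSum (μ := volume.restrict (Set.Ioc 0 (2 * Real.pi)))
      Finset.univ fun j _ => hi (max (Θ i) (Θ j)) 0,
      fun i j => setIntegral_ite_le_mul_pow 0 (hmax i j),
      fun i => setIntegral_ite_le_mul_pow 1 (hmem i), ← Finset.sum_div]
    simp only [zero_add, pow_one, CharP.cast_eq_zero, div_one, Finset.sum_sub_distrib,
      Finset.sum_const, Finset.card_univ, Fintype.card_fin, nsmul_eq_mul]
    push_cast
    field_simp
    ring
  have hD : IntegrableOn (circDiscrepancy Θ) (Set.Ioc 0 (2 * Real.pi)) := by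
    refine Integrable.congr ?_ (Filter.Eventually.of_forall fun x => (hexp x).symm)
    exact (((integrable_finsetSum _ fun i _ => hi (Θ i) 0).const_mul _).sub
      ((hpow 1).const_mul _)).add (integrable_const 0)
  have hD2 : IntegrableOn (fun x => circDiscrepancy Θ x ^ 2) (Set.Ioc 0 (2 * Real.pi)) := by
    refine Integrable.congr ?_ (Filter.Eventually.of_forall fun x => (hsqexp x).symm)
    exact (((integrable_finsetSum _ fun i _ =>
      integrable_finsetSum _ fun j _ => hi (max (Θ i) (Θ j)) 0).const_mul _).sub
      ((integrable_finsetSum _ fun i _ => hi (Θ i) 1).const_mul _)).add ((hpow 2).const_mul _)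
  rw [watson, intervalIntegral.integral_of_le (by positivity),
    intervalIntegral.integral_of_le (by positivity), I1]
  set μ := (2 * Real.pi)⁻¹ * (Real.pi - (n : ℝ)⁻¹ * ∑ i, Θ i) with hμ
  have hsq : ∀ x, (circDiscrepancy Θ x - μ) ^ 2 =
      1 * circDiscrepancy Θ x ^ 2 - (2 * μ) * circDiscrepancy Θ x + μ ^ 2 := fun x => by ring
  simp_rw [hsq]
  rw [integral_mul_sub_mul_add hD2 hD (integrable_const _), I1, I2, setIntegral_const, hμ]
  simp only [Real.volume_real_Ioc_of_le (by positivity : (0 : ℝ) ≤ 2 * Real.pi), smul_eq_mul,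
    sub_zero]
  field_simp
  ring

lemma P_one_eq_two_mul_watson {n : ℕ} (hn : 1 ≤ n) {Θ : Fin n → ℝ} {X : Fin n → Sphere 1}
    (hΘ : ∀ i, Θ i ∈ Set.Ico 0 (2 * Real.pi))
    (hX : ∀ i, (X i : EuclideanSpace ℝ (Fin 2)) 0 = Real.cos (Θ i) ∧
      (X i : EuclideanSpace ℝ (Fin 2)) 1 = Real.sin (Θ i)) :
    P cvmCdf 1 X = 2 * watson Θ := by
  have hpi := Real.pi_pos
  have hn0 : (n : ℝ) ≠ 0 := by positivity
  rw [P_eq_double_sum 0 hn X, watson_eq hn hΘ]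
  have hsum : ∑ i, ∑ j, psi cvmCdf 1 (angle (X i) (X j)) =
      n ^ 2 / 2 + (2 * n * ∑ i, Θ i ^ 2 - 2 * (∑ i, Θ i) ^ 2) / (4 * Real.pi ^ 2) -
        (2 * (∑ i, ∑ j, max (Θ i) (Θ j)) - 2 * n * ∑ i, Θ i) / (2 * Real.pi) := by
    simp_rw [fun i j => psi_one_angle (hΘ i) (hΘ j) (hX i) (hX j), sub_sq]
    simp only [Finset.sum_sub_distrib, Finset.sum_add_distrib, ← Finset.sum_div, Finset.sum_const,
      Finset.card_univ, Fintype.card_fin, nsmul_eq_mul, ← Finset.mul_sum, ← Finset.sum_mul]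
    field_simp
    ring
  change (n : ℝ)⁻¹ * (∑ i, ∑ j, psi cvmCdf 1 (angle (X i) (X j))) - n / 3 = _
  rw [hsum]
  field_simp
  ring

/-- The chord at polar angle α is √(2 - 2 cos α) = 2 sin(α/2), and α has density sin α / 2. -/
lemma integral_norm_sub_uniformSphere_two (u : Sphere 2) :
    ∫ v : Sphere 2, ‖(u : EuclideanSpace ℝ (Fin 3)) - v‖ ∂uniformSphere 2 = 4 / 3 := by
  have hpt : ∀ v : Sphere 2, ‖(u : EuclideanSpace ℝ (Fin 3)) - v‖ =
      Real.sqrt (2 - 2 * ⟪(v : EuclideanSpace ℝ (Fin 3)), (u : EuclideanSpace ℝ (Fin 3))⟫) := by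
    intro v
    rw [eq_comm, Real.sqrt_eq_iff_eq_sq, norm_sub_sq_real, norm_coe_sphere, norm_coe_sphere,
      real_inner_comm]
    · ring
    · have := (inner_mem_Icc v (norm_coe_sphere u)).2
      linarith
    · exact norm_nonneg _
  simp_rw [hpt]
  rw [integral_inner 1 (norm_coe_sphere u) (g := fun t => Real.sqrt (2 - 2 * t)) (by fun_prop),
    integral_projLaw 1 (by fun_prop), integral_angleLaw, ← integral_Ioc_eq_integral_Ioo,
    ← intervalIntegral.integral_of_le Real.pi_pos.le]
  have hcongr : ∀ α ∈ Set.uIcc 0 Real.pi, Real.sin α ^ 1 * Real.sqrt (2 - 2 * Real.cos α) =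
      4 * Real.sin (α / 2) ^ 2 * Real.cos (α / 2) := by
    intro α hα
    rw [Set.uIcc_of_le Real.pi_pos.le] at hα
    have hs := Real.sin_nonneg_of_nonneg_of_le_pi (x := α / 2) (by linarith [hα.1])
      (by linarith [hα.2, hα.1])
    have h1 := Real.cos_two_mul (α / 2)
    have h2 := Real.sin_two_mul (α / 2)
    rw [mul_div_cancel₀ α two_ne_zero] at h1 h2
    have h3 : 2 - 2 * Real.cos α = (2 * Real.sin (α / 2)) ^ 2 := by
      rw [h1, Real.cos_sq']; ring
    rw [h3, Real.sqrt_sq (by positivity), h2]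
    ring
  have hprim : ∀ α : ℝ, HasDerivAt (fun α => 8 / 3 * Real.sin (α / 2) ^ 3)
      (4 * Real.sin (α / 2) ^ 2 * Real.cos (α / 2)) α := by
    intro α
    refine ((((hasDerivAt_id' α).div_const 2).sin.pow 3).const_mul (8 / 3)).congr_deriv ?_
    ring
  rw [intervalIntegral.integral_congr hcongr,
    intervalIntegral.integral_eq_sub_of_hasDerivAt (fun α _ => hprim α)
      ((by fun_prop : Continuous fun α : ℝ =>
        4 * Real.sin (α / 2) ^ 2 * Real.cos (α / 2)).intervalIntegrable _ _)]
  simp only [sinInt, pow_one, integral_sin, Real.cos_pi, Real.cos_zero, Real.sin_pi_div_two,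
    zero_div, Real.sin_zero]
  norm_num

/-- The constants agree: n/2 - n/3 = n/6 is one eighth of n times the mean chord 4/3. -/
lemma P_two_eq_bakshaev {n : ℕ} (hn : 1 ≤ n) (X : Fin n → Sphere 2) :
    P cvmCdf 2 X = 1 / 8 * bakshaev 2 X := by
  have hn0 : (n : ℝ) ≠ 0 := by positivity
  rw [P_eq_double_sum 1 hn X, bakshaev]
  simp_rw [integral_norm_sub_uniformSphere_two]
  have hpsi : ∀ i j, psi cvmCdf (1 + 1) (angle (X i) (X j)) = 1 / 2 -
      ‖(X i : EuclideanSpace ℝ (Fin 3)) - X j‖ / 8 := fun i j =>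
    psi_two_eq_norm (norm_coe_sphere _) (norm_coe_sphere _) (cos_angle _ _)
  simp_rw [hpsi]
  simp only [Finset.sum_sub_distrib, Finset.sum_const, Finset.card_univ, Fintype.card_fin,
    nsmul_eq_mul, ← Finset.sum_div, integral_const, probReal_univ, smul_eq_mul, one_mul]
  field_simp
  ring

end ProjUnif

theorem mainTheorem6 :
    (∀ q n : ℕ, 1 ≤ q → 1 ≤ n → ∀ X : Fin n → ProjUnif.Sphere q,
      ProjUnif.P ProjUnif.cvmCdf q X =
        2 / (n : ℝ) * (∑ i, ∑ j ∈ Finset.Ioi i,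
          ProjUnif.psi ProjUnif.cvmCdf q (ProjUnif.angle (X i) (X j)))
        + (3 - 2 * (n : ℝ)) / 6) ∧
    (∀ θ ∈ Set.Icc 0 Real.pi,
      ProjUnif.psi ProjUnif.cvmCdf 1 θ =
        1 / 2 + θ / (2 * Real.pi) * (θ / (2 * Real.pi) - 1)) ∧
    (∀ θ ∈ Set.Icc 0 Real.pi,
      ProjUnif.psi ProjUnif.cvmCdf 2 θ = 1 / 2 - 1 / 4 * Real.sin (θ / 2)) ∧
    (∀ θ ∈ Set.Ico 0 Real.pi,
      ProjUnif.psi ProjUnif.cvmCdf 3 θ =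
        ProjUnif.psi ProjUnif.cvmCdf 1 θ +
          1 / (4 * Real.pi ^ 2) *
            ((Real.pi - θ) * Real.tan (θ / 2) - 2 * Real.sin (θ / 2) ^ 2)) ∧
    ProjUnif.psi ProjUnif.cvmCdf 3 Real.pi = 1 / 4 ∧
    (∀ q : ℕ, 2 ≤ q → ∀ θ ∈ Set.Icc 0 Real.pi,
      ProjUnif.psi ProjUnif.cvmCdf q θ =
        -(3 / 4) + θ / (2 * Real.pi) + 2 * ProjUnif.F q (Real.cos (θ / 2)) ^ 2 -
          4 * ∫ t in (0 : ℝ)..Real.cos (θ / 2),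
            ProjUnif.F q t *
              ProjUnif.F (q - 1) (t * Real.tan (θ / 2) / Real.sqrt (1 - t ^ 2))
            ∂(ProjUnif.F q).measure) ∧
    (∀ n : ℕ, 1 ≤ n → ∀ (Θ : Fin n → ℝ) (X : Fin n → ProjUnif.Sphere 1),
      (∀ i, Θ i ∈ Set.Ico 0 (2 * Real.pi)) →
      (∀ i, (X i : EuclideanSpace ℝ (Fin 2)) 0 = Real.cos (Θ i) ∧
        (X i : EuclideanSpace ℝ (Fin 2)) 1 = Real.sin (Θ i)) →
      ProjUnif.P ProjUnif.cvmCdf 1 X = 2 * ProjUnif.watson Θ) ∧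
    (∀ n : ℕ, 1 ≤ n → ∀ X : Fin n → ProjUnif.Sphere 2,
      ProjUnif.P ProjUnif.cvmCdf 2 X = 1 / 8 * ProjUnif.bakshaev 2 X) := by
  refine ⟨?_, fun θ hθ => ProjUnif.psi_one hθ, fun θ hθ => ProjUnif.psi_two hθ,
    fun θ hθ => ProjUnif.psi_three hθ, ProjUnif.psi_pi 2, ?_,
    fun n hn Θ X hΘ hX => ProjUnif.P_one_eq_two_mul_watson hn hΘ hX,
    fun n hn X => ProjUnif.P_two_eq_bakshaev hn X⟩
  · intro q n hq hn X
    obtain ⟨m, rfl⟩ := Nat.exists_eq_add_of_le' hq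
    exact ProjUnif.P_eq_sum_pairs m hn X
  · intro q hq θ hθ
    obtain ⟨k, rfl⟩ := Nat.exists_eq_add_of_le' hq
    have hc : 0 ≤ Real.cos (θ / 2) :=
      Real.cos_nonneg_of_mem_Icc ⟨by linarith [hθ.1, Real.pi_pos], by linarith [hθ.2]⟩
    rw [ProjUnif.psi_formula k hθ, intervalIntegral.integral_of_le hc, ProjUnif.measure_F]
    rfl
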